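/- Let $k$ be a field, let $Q$ be the cyclically oriented quiver with vertices $1,\dots,n$ ($n\ge 1$) and arrows $\alpha_i\colon i\to i+1$ (indices modulo $n$), and let $\Lambda=kQ/I$ be a cyclic Nakayama algebra, where $I$ is the ideal generated by a non-empty finite irredundant system of zero relations $\alpha_{b}\cdots\alpha_{a+1}\alpha_{a}=0$, each a path of length at least $2$ (irredundant: none of these paths is a subpath of another). All modules are finitely generated left $\Lambda$-modules, and $\Omega M$ denotes the kernel of a projective cover of $M$, with $\Omega^0M=M$. - The finitistic dimension $\operatorname{findim}\Lambda$ is the supremum of the projective dimensions of the modules of finite projective dimension. - The delooping level $\operatorname{del}M$ of a module $M$ is the least $d\ge 0$ such that $\Omega^dM$ is isomorphic to a direct summand of $\Lambda\oplus\Omega^{d+1}M'$ for some module $M'$ (and $\infty$ if there is no such $d$); $\operatorname{del}\Lambda$ is the maximum of $\operatorname{del}S$ over the simple $\Lambda$-modules $S$. - Let $K_0$ be the abelian group generated by the symbols $[M]$ of modules, subject to $[Z]=[X]+[Y]$ whenever $Z\cong X\oplus Y$ and $[P]=0$ for $P$ projective, and let $L\colon K_0\to K_0$ be the endomorphism $L[M]=[\Omega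 M]$. For a module $M$ let $\langle\operatorname{add}M\rangle\subseteq K_0$ be the subgroup generated by the classes of the direct summands of finite direct sums of copies of $M$, and let $\varphi(M)$ be the least $t\ge0$ with $\operatorname{rank}L^t\langle\operatorname{add}M\rangle=\operatorname{rank}L^{t+j}\langle\operatorname{add}M\rangle$ for all $j\ge1$. The $\varphi$-dimension $\varphi\dim\Lambda$ is the supremum of $\varphi(M)$ over all modules $M$. **Proposition.** If $\varphi\dim\Lambda=2$, then $$\operatorname{findim}\Lambda=1\iff\operatorname{del}\Lambda=1\qquad\text{and}\qquad\operatorname{findim}\Lambda=2\iff\operatorname{del}\Lambda=2 .$$ -/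

import Mathlib

open CategoryTheory

universe u

/-! ## Homological notions for finitely generated left modules over an Artinian ring -/

noncomputable section

namespace Homological

variable {A : Type u} [Ring A]

/-- `π : P → M` is a projective cover: `P` is projective and `π` is surjective with superfluous
kernel. -/
structure IsProjectiveCover {P M : FGModuleCat.{u} A} (π : P →ₗ[A] M) : Prop where
  projective : Module.Projective A P
  surjective : Function.Surjective π
  superfluous : ∀ N : Submodule A P, N ⊔ LinearMap.ker π = ⊤ → N = ⊤

section Cover

variable [IsArtinianRing A]

/-- Finitely generated modules over an Artinian ring have projective covers. -/
theorem exists_isProjectiveCover (M : FGModuleCat.{u} A) :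
    ∃ (P : FGModuleCat.{u} A) (π : P →ₗ[A] M), IsProjectiveCover π := by
  classical
  have hex : ∃ (n : ℕ) (P : FGModuleCat.{u} A) (π : P →ₗ[A] M), Module.Projective A P ∧
      Function.Surjective π ∧ Module.length A P = n := by
    obtain ⟨m, f, hf⟩ := Module.Finite.exists_fin' A M
    have hfin : Module.length A (Fin m → A) ≠ ⊤ := Module.length_ne_top
    obtain ⟨n, hn⟩ := ENat.ne_top_iff_exists.mp hfin
    exact ⟨n, FGModuleCat.of A (Fin m → A), f, inferInstanceAs (Module.Projective A (Fin m → A)),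
      hf, hn.symm⟩
  obtain ⟨P, π, hP, hπ, hlen⟩ := Nat.find_spec hex
  refine ⟨P, π, hP, hπ, fun N hN => ?_⟩
  have hsurj : Function.Surjective (π ∘ₗ N.subtype) := by
    rw [← LinearMap.range_eq_top, LinearMap.range_comp, Submodule.range_subtype]
    have h := congrArg (Submodule.map π) hN
    rw [Submodule.map_sup, Submodule.map_top, LinearMap.range_eq_top.mpr hπ] at h
    rw [← h]
    symm
    rw [sup_eq_left, Submodule.map_le_iff_le_comap]
    intro x hx
    rw [Submodule.mem_comap, LinearMap.mem_ker.mp hx]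
    exact Submodule.zero_mem _
  obtain ⟨f, hf⟩ := Module.projective_lifting_property (π ∘ₗ N.subtype) π hsurj
  let g : Module.End A P := N.subtype ∘ₗ f
  have hg : ∀ x, π (g x) = π x := fun x => LinearMap.congr_fun hf x
  have hgk : ∀ (j : ℕ) (x : P), π ((g ^ j) x) = π x := by
    intro j
    induction j with
    | zero => intro x; simp
    | succ j ih => intro x; rw [pow_succ', Module.End.mul_apply, hg, ih]
  obtain ⟨j, hj1, hj⟩ := ((Filter.eventually_ge_atTop 1).and
    g.eventually_isCompl_ker_pow_range_pow).exists
  have hQ : Module.Projective A (LinearMap.range (g ^ j)) :=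
    Module.Projective.of_split (LinearMap.range (g ^ j)).subtype
      ((LinearMap.range (g ^ j)).projectionOnto _ hj.symm)
      (by ext x; simp)
  have hQs : Function.Surjective (π ∘ₗ (LinearMap.range (g ^ j)).subtype) := by
    intro y
    obtain ⟨x, rfl⟩ := hπ y
    exact ⟨⟨(g ^ j) x, x, rfl⟩, hgk j x⟩
  have htop : LinearMap.range (g ^ j) = ⊤ := by
    by_contra hne
    have hlt := Submodule.length_lt hne
    rw [hlen] at hlt
    obtain ⟨m, hm⟩ := ENat.ne_top_iff_exists.mp hlt.ne_top
    rw [← hm] at hlt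
    exact Nat.find_min hex (ENat.natCast_lt_natCast.mp hlt)
      ⟨FGModuleCat.of A (LinearMap.range (g ^ j)), _, hQ, hQs, hm.symm⟩
  rw [eq_top_iff, ← htop]
  rintro _ ⟨x, rfl⟩
  obtain ⟨i, rfl⟩ := Nat.exists_eq_add_of_le hj1
  rw [add_comm, pow_succ']
  exact (f ((g ^ i) x)).2

/-- A chosen projective cover of `M`; it is unique up to isomorphism over `M`. -/
def coverModule (M : FGModuleCat.{u} A) : FGModuleCat.{u} A :=
  (exists_isProjectiveCover M).choose

def coverMap (M : FGModuleCat.{u} A) : coverModule M →ₗ[A] M :=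
  (exists_isProjectiveCover M).choose_spec.choose

theorem isProjectiveCover_coverMap (M : FGModuleCat.{u} A) : IsProjectiveCover (coverMap M) :=
  (exists_isProjectiveCover M).choose_spec.choose_spec

/-- The syzygy `Ω M`, the kernel of the projective cover of `M`. The iterate `syzygy^[d] M` is
`Ω^d M`, with `Ω^0 M = M`. -/
def syzygy (M : FGModuleCat.{u} A) : FGModuleCat.{u} A :=
  FGModuleCat.of A (LinearMap.ker (coverMap M))

end Cover

/-- `N` is (isomorphic to) a direct summand of `X`. -/
def IsDirectSummand (N X : Type u) [AddCommGroup N] [Module A N] [AddCommGroup X] [Module A X] :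
    Prop :=
  ∃ (i : N →ₗ[A] X) (p : X →ₗ[A] N), p ∘ₗ i = LinearMap.id

/-! ### Finitistic dimension and delooping level -/

variable (A) in
/-- The finitistic dimension: the supremum of the projective dimensions of the finitely generated
modules of finite projective dimension. -/
def findim : WithBot ℕ∞ :=
  ⨆ (M : FGModuleCat.{u} A) (_ : projectiveDimension M.obj ≠ ⊤), projectiveDimension M.obj

section Delooping

variable [IsArtinianRing A]

/-- The delooping level of `M`: the least `d` such that `Ω^d M` is a direct summand of
`A ⊕ Ω^(d+1) M'` for some finitely generated `M'`, and `∞` if there is no such `d`. -/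
def delModule (M : FGModuleCat.{u} A) : ℕ∞ :=
  sInf {d : ℕ∞ | ∃ t : ℕ, d = t ∧ ∃ M' : FGModuleCat.{u} A,
    IsDirectSummand (A := A) (syzygy^[t] M) (A × (syzygy^[t + 1] M' : FGModuleCat.{u} A))}

variable (A) in
/-- The delooping level of `A`: the maximum of the delooping levels of the simple modules. -/
def del : ℕ∞ :=
  ⨆ (S : FGModuleCat.{u} A) (_ : IsSimpleModule A S), delModule S

end Delooping

/-! ### The Igusa-Todorov function and the `φ`-dimension -/

variable (A) in
/-- The relations of the group `K₀`: `[Z] = [X] + [Y]` whenever `Z ≅ X ⊕ Y`, and `[P] = 0` for `P`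
projective. -/
def K0Rel : Set (FreeAbelianGroup (FGModuleCat.{u} A)) :=
  {c | ∃ X Y Z : FGModuleCat.{u} A, Nonempty (Z ≃ₗ[A] X × Y) ∧
    c = FreeAbelianGroup.of Z - (FreeAbelianGroup.of X + FreeAbelianGroup.of Y)} ∪
  {c | ∃ P : FGModuleCat.{u} A, Module.Projective A P ∧ c = FreeAbelianGroup.of P}

variable (A) in
/-- The group `K₀` of Igusa and Todorov: the abelian group generated by the symbols `[M]`, for `M`
a finitely generated module, modulo `[X ⊕ Y] = [X] + [Y]` and `[P] = 0` for `P` projective. -/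
abbrev K0 : Type (u + 1) :=
  FreeAbelianGroup (FGModuleCat.{u} A) ⧸ AddSubgroup.closure (K0Rel A)

/-- The class `[M]` in `K₀`. -/
def K0.mk (M : FGModuleCat.{u} A) : K0 A :=
  QuotientAddGroup.mk (FreeAbelianGroup.of M)

theorem K0.mk_eq_add {X Y Z : FGModuleCat.{u} A} (e : Z ≃ₗ[A] X × Y) :
    K0.mk Z = K0.mk X + K0.mk Y := by
  have h : (QuotientAddGroup.mk (FreeAbelianGroup.of Z -
      (FreeAbelianGroup.of X + FreeAbelianGroup.of Y)) : K0 A) = 0 :=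
    (QuotientAddGroup.eq_zero_iff _).mpr
      (AddSubgroup.subset_closure (Or.inl ⟨X, Y, Z, ⟨e⟩, rfl⟩))
  exact sub_eq_zero.mp h

theorem K0.mk_eq_zero {P : FGModuleCat.{u} A} (hP : Module.Projective A P) : K0.mk P = 0 :=
  (QuotientAddGroup.eq_zero_iff _).mpr (AddSubgroup.subset_closure (Or.inr ⟨P, hP, rfl⟩))

/-- Schanuel's lemma, as an isomorphism of a pullback with a product. -/
theorem exists_pullback_equiv {P Q M : Type u} [AddCommGroup P] [Module A P] [AddCommGroup Q]
    [Module A Q] [AddCommGroup M] [Module A M] (f : P →ₗ[A] M) (g : Q →ₗ[A] M)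
    (hg : Function.Surjective g) [Module.Projective A P] :
    Nonempty (LinearMap.ker (f.coprod (-g)) ≃ₗ[A] P × LinearMap.ker g) := by
  obtain ⟨s, hs⟩ := Module.projective_lifting_property g f hg
  have hs' : ∀ x, g (s x) = f x := fun x => LinearMap.congr_fun hs x
  have key : ∀ z : LinearMap.ker (f.coprod (-g)), f z.1.1 = g z.1.2 := fun z => by
    have := z.2
    rw [LinearMap.mem_ker, LinearMap.coprod_apply, LinearMap.neg_apply] at this
    exact add_neg_eq_zero.mp this
  refine ⟨
    { toFun := fun z => (z.1.1, ⟨z.1.2 - s z.1.1, by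
        rw [LinearMap.mem_ker, map_sub, hs', key, sub_self]⟩)
      map_add' := fun x y => by
        ext
        · simp
        · simp only [Submodule.coe_add, Prod.fst_add, Prod.snd_add, map_add]
          abel
      map_smul' := fun a x => by
        ext <;> simp [smul_sub]
      invFun := fun w => ⟨(w.1, w.2.1 + s w.1), by
        rw [LinearMap.mem_ker, LinearMap.coprod_apply, LinearMap.neg_apply, map_add, hs',
          LinearMap.mem_ker.mp w.2.2]
        simp⟩
      left_inv := fun z => by
        ext <;> simp
      right_inv := fun w => by
        ext <;> simp }⟩

theorem schanuel {P Q M : Type u} [AddCommGroup P] [Module A P] [AddCommGroup Q]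
    [Module A Q] [AddCommGroup M] [Module A M] (f : P →ₗ[A] M) (g : Q →ₗ[A] M)
    (hf : Function.Surjective f) (hg : Function.Surjective g) [Module.Projective A P]
    [Module.Projective A Q] :
    Nonempty ((P × LinearMap.ker g) ≃ₗ[A] (Q × LinearMap.ker f)) := by
  obtain ⟨e₁⟩ := exists_pullback_equiv f g hg
  obtain ⟨e₂⟩ := exists_pullback_equiv g f hf
  let sw : LinearMap.ker (f.coprod (-g)) ≃ₗ[A] LinearMap.ker (g.coprod (-f)) :=
    LinearEquiv.ofSubmodules (LinearEquiv.prodComm A P Q) _ _ (by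
      ext ⟨q, p⟩
      simp only [Submodule.mem_map, LinearMap.mem_ker, LinearMap.coprod_apply,
        LinearMap.neg_apply, Prod.exists]
      constructor
      · rintro ⟨a, b, h, hab⟩
        obtain ⟨rfl, rfl⟩ := Prod.mk.inj hab
        rw [add_neg_eq_zero] at h ⊢
        exact h.symm
      · intro h
        refine ⟨p, q, ?_, rfl⟩
        rw [add_neg_eq_zero] at h ⊢
        exact h.symm)
  exact ⟨(e₁.symm.trans sw).trans e₂⟩

section Phi

variable [IsArtinianRing A]

/-- The class of the syzygy can be computed from any presentation by a projective module. -/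
theorem K0.mk_syzygy {P M : FGModuleCat.{u} A} (hP : Module.Projective A P) (f : P →ₗ[A] M)
    (hf : Function.Surjective f) :
    K0.mk (syzygy M) = K0.mk (FGModuleCat.of A (LinearMap.ker f)) := by
  have hc := isProjectiveCover_coverMap M
  have := hc.projective
  obtain ⟨e⟩ := schanuel f (coverMap M) hf hc.surjective
  have h₁ := K0.mk_eq_add (X := P) (Y := syzygy M)
    (Z := FGModuleCat.of A (P × LinearMap.ker (coverMap M))) (LinearEquiv.refl A _)
  have h₂ := K0.mk_eq_add (X := coverModule M) (Y := FGModuleCat.of A (LinearMap.ker f))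
    (Z := FGModuleCat.of A (P × LinearMap.ker (coverMap M))) e
  rw [K0.mk_eq_zero hP, zero_add] at h₁
  rw [K0.mk_eq_zero hc.projective, zero_add] at h₂
  rw [← h₁, h₂]

variable (A) in
/-- The endomorphism `L` of `K₀` with `L [M] = [Ω M]`. -/
def L : AddMonoid.End (K0 A) :=
  QuotientAddGroup.lift _ (FreeAbelianGroup.lift fun M => K0.mk (syzygy M)) (by
    rw [AddSubgroup.closure_le]
    rintro c (⟨X, Y, Z, ⟨e⟩, rfl⟩ | ⟨P, hP, rfl⟩)
    · have hX := isProjectiveCover_coverMap X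
      have hY := isProjectiveCover_coverMap Y
      have := hX.projective
      have := hY.projective
      let F : (coverModule X × coverModule Y) →ₗ[A] Z :=
        e.symm.toLinearMap ∘ₗ (coverMap X).prodMap (coverMap Y)
      have hF : Function.Surjective F :=
        e.symm.surjective.comp (Function.Surjective.prodMap hX.surjective hY.surjective)
      have h := K0.mk_syzygy (P := FGModuleCat.of A (coverModule X × coverModule Y)) (M := Z)
        (inferInstanceAs (Module.Projective A (coverModule X × coverModule Y))) F hF
      have hk : LinearMap.ker F = (LinearMap.ker (coverMap X)).prod (LinearMap.ker (coverMap Y)) := by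
        rw [LinearEquiv.ker_comp, LinearMap.ker_prodMap]
      have e' : LinearMap.ker F ≃ₗ[A] LinearMap.ker (coverMap X) × LinearMap.ker (coverMap Y) :=
        (LinearEquiv.ofEq _ _ hk).trans
          { toFun := fun z => (⟨z.1.1, z.2.1⟩, ⟨z.1.2, z.2.2⟩)
            map_add' := fun _ _ => rfl
            map_smul' := fun _ _ => rfl
            invFun := fun w => ⟨(w.1.1, w.2.1), w.1.2, w.2.2⟩
            left_inv := fun _ => rfl
            right_inv := fun _ => rfl }
      have h' := K0.mk_eq_add (X := syzygy X) (Y := syzygy Y)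
        (Z := FGModuleCat.of A (LinearMap.ker F)) e'
      simp only [SetLike.mem_coe, AddMonoidHom.mem_ker, map_sub, map_add,
        FreeAbelianGroup.lift_apply_of]
      rw [h, h', sub_self]
    · have h := K0.mk_syzygy (M := P) hP LinearMap.id Function.surjective_id
      simp only [SetLike.mem_coe, AddMonoidHom.mem_ker, FreeAbelianGroup.lift_apply_of]
      rw [h]
      refine K0.mk_eq_zero (P := FGModuleCat.of A (LinearMap.ker LinearMap.id)) ?_
      have hs : Subsingleton (LinearMap.ker (LinearMap.id : P →ₗ[A] P)) := by
        rw [LinearMap.ker_id]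
        infer_instance
      exact inferInstanceAs (Module.Projective A (LinearMap.ker (LinearMap.id : P →ₗ[A] P))))

theorem L_mk (M : FGModuleCat.{u} A) : L A (K0.mk M) = K0.mk (syzygy M) :=
  FreeAbelianGroup.lift_apply_of _ _

/-- The subgroup `⟨add M⟩` of `K₀` generated by the classes of the modules in `add M`, that is of
the direct summands of finite direct sums of copies of `M`. -/
def addSubgroup (M : FGModuleCat.{u} A) : AddSubgroup (K0 A) :=
  AddSubgroup.closure {c | ∃ X : FGModuleCat.{u} A,
    (∃ m : ℕ, IsDirectSummand (A := A) X (Fin m → M)) ∧ c = K0.mk X}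

/-- The rank of the abelian group `L^t ⟨add M⟩`. -/
def rankL (M : FGModuleCat.{u} A) (t : ℕ) : Cardinal.{u + 1} :=
  Module.rank ℤ ((addSubgroup M).map (L A ^ t : AddMonoid.End (K0 A)))

/-- The Igusa-Todorov function `φ(M)`. -/
def phi (M : FGModuleCat.{u} A) : ℕ∞ :=
  sInf {d : ℕ∞ | ∃ t : ℕ, d = t ∧ ∀ j : ℕ, 1 ≤ j → rankL M t = rankL M (t + j)}

variable (A) in
/-- The `φ`-dimension of `A`. -/
def phiDim : ℕ∞ :=
  ⨆ M : FGModuleCat.{u} A, phi M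

end Phi

end Homological

/-! ## Cyclic Nakayama algebras -/

/-- A path in the cyclic quiver with vertex set `ZMod n` and one arrow `α_i : i → i + 1` for every
vertex `i`. A path is determined by its source and its length: `⟨i, l⟩` is the path
`α_{i+l-1} ⋯ α_{i+1} α_i`, and `⟨i, 0⟩` is the trivial path at `i`. -/
@[ext]
structure CyclicPath (n : ℕ) where
  source : ZMod n
  length : ℕ

namespace CyclicPath

variable {n : ℕ}

/-- The end vertex of a path. -/
def target (p : CyclicPath n) : ZMod n := p.source + p.length

/-- `p.after q` is the path `p q`, first `q` and then `p`; meaningful if `q` ends where `p`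
starts. -/
def after (p q : CyclicPath n) : CyclicPath n := ⟨q.source, q.length + p.length⟩

/-- `p` is a subpath of `q`: `q = x p y` for some paths `x` and `y`. -/
def IsSubpath (p q : CyclicPath n) : Prop :=
  ∃ x y : CyclicPath n, y.target = p.source ∧ p.target = x.source ∧ q = x.after (p.after y)

end CyclicPath

/-- The path algebra `kQ` of the cyclic quiver `Q` with `n` vertices: the vector space with basis
the paths of `Q`. -/
def PathAlgebra (k : Type u) (n : ℕ) [Field k] : Type u := CyclicPath n →₀ k

namespace PathAlgebra

variable {k : Type u} {n : ℕ} [Field k]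

instance : AddCommGroup (PathAlgebra k n) := inferInstanceAs (AddCommGroup (CyclicPath n →₀ k))

instance : Module k (PathAlgebra k n) := inferInstanceAs (Module k (CyclicPath n →₀ k))

/-- The multiple `c p` of the basis element `p`. -/
def monomial (p : CyclicPath n) (c : k) : PathAlgebra k n := Finsupp.single p c

/-- The product `c (p q)`: it is zero unless `q` ends where `p` starts. -/
def monomialMul (p q : CyclicPath n) (c : k) : PathAlgebra k n :=
  if q.target = p.source then monomial (p.after q) c else 0

/-- The bilinear multiplication extending the concatenation of paths. -/
instance : Mul (PathAlgebra k n) :=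
  ⟨fun f g => Finsupp.sum f fun p a => Finsupp.sum g fun q b => monomialMul p q (a * b)⟩

/-- The unit is the sum of the trivial paths. -/
instance [NeZero n] : One (PathAlgebra k n) := ⟨∑ i : ZMod n, monomial ⟨i, 0⟩ 1⟩

theorem monomial_zero (p : CyclicPath n) : monomial p (0 : k) = 0 := Finsupp.single_zero p

theorem monomial_add (p : CyclicPath n) (a b : k) :
    monomial p (a + b) = monomial p a + monomial p b := Finsupp.single_add p a b

theorem smul_monomial (p : CyclicPath n) (a b : k) :
    a • monomial p b = monomial p (a * b) := Finsupp.smul_single' a p b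

theorem monomialMul_zero (p q : CyclicPath n) : monomialMul p q (0 : k) = 0 := by
  simp [monomialMul, monomial_zero]

theorem monomialMul_add (p q : CyclicPath n) (a b : k) :
    monomialMul p q (a + b) = monomialMul p q a + monomialMul p q b := by
  unfold monomialMul
  split_ifs
  · exact monomial_add _ _ _
  · simp

theorem mul_def (f g : PathAlgebra k n) :
    f * g = Finsupp.sum f fun p a => Finsupp.sum g fun q b => monomialMul p q (a * b) := rfl

protected theorem zero_mul' (f : PathAlgebra k n) : 0 * f = 0 := Finsupp.sum_zero_index

protected theorem mul_zero' (f : PathAlgebra k n) : f * 0 = 0 := by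
  exact Finset.sum_eq_zero fun p _ => Finsupp.sum_zero_index

protected theorem add_mul' (f g h : PathAlgebra k n) : (f + g) * h = f * h + g * h := by
  classical
  refine Finsupp.sum_add_index' (fun p => ?_) (fun p a b => ?_)
  · simp only [zero_mul, monomialMul_zero]
    exact Finset.sum_eq_zero fun _ _ => rfl
  · simp only [add_mul, monomialMul_add]
    exact Finsupp.sum_add

protected theorem mul_add' (f g h : PathAlgebra k n) : f * (g + h) = f * g + f * h := by
  classical
  rw [mul_def, mul_def, mul_def]
  refine Eq.trans (Finsupp.sum_congr fun p _ => ?_) Finsupp.sum_add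
  refine Finsupp.sum_add_index' (fun q => ?_) (fun q a b => ?_)
  · rw [mul_zero, monomialMul_zero]
  · rw [mul_add, monomialMul_add]

theorem monomial_mul_monomial (p q : CyclicPath n) (a b : k) :
    monomial p a * monomial q b = monomialMul p q (a * b) := by
  rw [mul_def, monomial, monomial, Finsupp.sum_single_index, Finsupp.sum_single_index]
  · rw [mul_zero, monomialMul_zero]
  · simp only [zero_mul, monomialMul_zero]
    exact Finset.sum_eq_zero fun _ _ => rfl

theorem induction_on {C : PathAlgebra k n → Prop} (f : PathAlgebra k n) (h0 : C 0)
    (hadd : ∀ f g, C f → C g → C (f + g)) (hmon : ∀ p a, C (monomial p a)) : C f :=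
  Finsupp.induction_linear f h0 hadd hmon

instance : NonUnitalNonAssocRing (PathAlgebra k n) :=
  { (inferInstance : AddCommGroup (PathAlgebra k n)), (inferInstance : Mul (PathAlgebra k n)) with
    zero_mul := PathAlgebra.zero_mul'
    mul_zero := PathAlgebra.mul_zero'
    left_distrib := PathAlgebra.mul_add'
    right_distrib := PathAlgebra.add_mul' }

protected theorem mul_assoc' (f g h : PathAlgebra k n) : f * g * h = f * (g * h) := by
  induction f using induction_on with
  | h0 => simp
  | hadd f₁ f₂ h₁ h₂ => simp only [add_mul, h₁, h₂]
  | hmon p a =>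
    induction g using induction_on with
    | h0 => simp
    | hadd g₁ g₂ h₁ h₂ => simp only [add_mul, mul_add, h₁, h₂]
    | hmon q b =>
      induction h using induction_on with
      | h0 => simp
      | hadd g₁ g₂ h₁ h₂ => simp only [mul_add, h₁, h₂]
      | hmon r c =>
        simp only [monomial_mul_monomial, monomialMul]
        by_cases hqr : r.target = q.source
        · have ht : (q.after r).target = q.target := by
            simp only [CyclicPath.target, CyclicPath.after] at hqr ⊢
            rw [← hqr]; push_cast; ring
          by_cases hpq : q.target = p.source
          · rw [if_pos hpq, if_pos hqr, monomial_mul_monomial, monomial_mul_monomial, monomialMul,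
              monomialMul, if_pos (by simpa [CyclicPath.after] using hqr), if_pos (ht.trans hpq),
              mul_assoc]
            congr 1
            simp only [CyclicPath.after, add_assoc]
          · rw [if_neg hpq, if_pos hqr, monomial_mul_monomial, monomialMul,
              if_neg (by rwa [ht]), zero_mul]
        · rw [if_neg hqr, mul_zero]
          by_cases hpq : q.target = p.source
          · rw [if_pos hpq, monomial_mul_monomial, monomialMul,
              if_neg (by simpa [CyclicPath.after] using hqr)]
          · rw [if_neg hpq, zero_mul]

variable [NeZero n]

theorem one_def : (1 : PathAlgebra k n) = ∑ i : ZMod n, monomial ⟨i, 0⟩ 1 := rfl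

protected theorem one_mul' (f : PathAlgebra k n) : 1 * f = f := by
  induction f using induction_on with
  | h0 => simp
  | hadd f₁ f₂ h₁ h₂ => simp only [mul_add, h₁, h₂]
  | hmon p a =>
    simp [one_def, Finset.sum_mul, monomial_mul_monomial, monomialMul, CyclicPath.after]

protected theorem mul_one' (f : PathAlgebra k n) : f * 1 = f := by
  induction f using induction_on with
  | h0 => simp
  | hadd f₁ f₂ h₁ h₂ => simp only [add_mul, h₁, h₂]
  | hmon p a =>
    rw [one_def, Finset.mul_sum, Finset.sum_eq_single p.source]
    · simp [monomial_mul_monomial, monomialMul, CyclicPath.after, CyclicPath.target]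
    · intro i _ hi
      simp [monomial_mul_monomial, monomialMul, CyclicPath.target, hi]
    · simp

instance : Ring (PathAlgebra k n) :=
  { (inferInstance : NonUnitalNonAssocRing (PathAlgebra k n)),
    (inferInstance : One (PathAlgebra k n)) with
    mul_assoc := PathAlgebra.mul_assoc'
    one_mul := PathAlgebra.one_mul'
    mul_one := PathAlgebra.mul_one' }

instance : Algebra k (PathAlgebra k n) :=
  Algebra.ofModule
    (fun r f g => by
      induction f using induction_on with
      | h0 => simp
      | hadd f₁ f₂ h₁ h₂ => simp only [smul_add, add_mul, h₁, h₂]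
      | hmon p a =>
        induction g using induction_on with
        | h0 => simp
        | hadd g₁ g₂ h₁ h₂ => simp only [smul_add, mul_add, h₁, h₂]
        | hmon q b =>
          simp only [smul_monomial, monomial_mul_monomial, monomialMul]
          split_ifs
          · rw [smul_monomial, mul_assoc]
          · simp)
    (fun r f g => by
      induction f using induction_on with
      | h0 => simp
      | hadd f₁ f₂ h₁ h₂ => simp only [smul_add, add_mul, h₁, h₂]
      | hmon p a =>
        induction g using induction_on with
        | h0 => simp
        | hadd g₁ g₂ h₁ h₂ => simp only [smul_add, mul_add, h₁, h₂]
        | hmon q b =>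
          simp only [smul_monomial, monomial_mul_monomial, monomialMul]
          split_ifs
          · rw [smul_monomial, mul_left_comm]
          · simp)

end PathAlgebra

/-- An irredundant system of zero relations on the cyclic quiver with `n` vertices: a nonempty
finite set of paths of length at least two, none of which is a subpath of another one. -/
structure RelationSystem (n : ℕ) where
  rels : Finset (CyclicPath n)
  nonempty : rels.Nonempty
  two_le_length : ∀ p ∈ rels, 2 ≤ p.length
  irredundant : ∀ p ∈ rels, ∀ q ∈ rels, p.IsSubpath q → p = q

/-- The ideal `I` of the path algebra generated by the relations. -/
def RelationSystem.ideal (k : Type u) [Field k] {n : ℕ} [NeZero n] (R : RelationSystem n) :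
    Ideal (PathAlgebra k n) :=
  (TwoSidedIdeal.span {x | ∃ p ∈ R.rels, x = PathAlgebra.monomial p 1}).asIdeal

instance (k : Type u) [Field k] {n : ℕ} [NeZero n] (R : RelationSystem n) :
    (R.ideal k).IsTwoSided :=
  inferInstanceAs (TwoSidedIdeal.asIdeal _).IsTwoSided

/-- The cyclic Nakayama algebra `kQ / I`. -/
abbrev NakayamaAlgebra (k : Type u) [Field k] {n : ℕ} [NeZero n] (R : RelationSystem n) : Type u :=
  PathAlgebra k n ⧸ R.ideal k

namespace NakayamaAlgebra

variable (k : Type u) [Field k] {n : ℕ} [NeZero n] (R : RelationSystem n)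

/-- Long paths lie in the ideal. -/
theorem monomial_mem_ideal {r p : CyclicPath n} (hr : r ∈ R.rels) (hp : n + r.length ≤ p.length)
    (a : k) : PathAlgebra.monomial p a ∈ R.ideal k := by
  let y : CyclicPath n := ⟨p.source, (r.source - p.source).val⟩
  let x : CyclicPath n := ⟨r.target, p.length - y.length - r.length⟩
  have hy : y.length < n := ZMod.val_lt _
  have hyt : y.target = r.source := by
    simp [y, CyclicPath.target]
  have hrm : PathAlgebra.monomial r (1 : k) ∈ TwoSidedIdeal.span
      {x | ∃ p ∈ R.rels, x = PathAlgebra.monomial p (1 : k)} :=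
    TwoSidedIdeal.subset_span ⟨r, hr, rfl⟩
  have hm : PathAlgebra.monomial x a * (PathAlgebra.monomial r (1 : k) *
      PathAlgebra.monomial y 1) ∈ TwoSidedIdeal.span
      {x | ∃ p ∈ R.rels, x = PathAlgebra.monomial p (1 : k)} :=
    TwoSidedIdeal.mul_mem_left _ _ _ (TwoSidedIdeal.mul_mem_right _ _ _ hrm)
  have hrt : (r.after y).target = x.source := by
    simp only [CyclicPath.target, CyclicPath.after, x] at hyt ⊢
    rw [← hyt]; push_cast; ring
  have he : x.after (r.after y) = p := by
    ext
    · rfl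
    · simp only [CyclicPath.after, x]
      omega
  rw [PathAlgebra.monomial_mul_monomial, PathAlgebra.monomialMul, if_pos hyt,
    PathAlgebra.monomial_mul_monomial, PathAlgebra.monomialMul, if_pos hrt, he, one_mul,
    mul_one] at hm
  exact hm

instance finite : Module.Finite k (NakayamaAlgebra k R) := by
  classical
  obtain ⟨r, hr⟩ := R.nonempty
  let s : Finset (NakayamaAlgebra k R) :=
    (Finset.univ ×ˢ Finset.range (n + r.length)).image fun w : ZMod n × ℕ =>
      Ideal.Quotient.mk (R.ideal k) (PathAlgebra.monomial ⟨w.1, w.2⟩ 1)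
  refine ⟨⟨s, eq_top_iff.mpr fun x _ => ?_⟩⟩
  obtain ⟨f, rfl⟩ := Ideal.Quotient.mk_surjective x
  induction f using PathAlgebra.induction_on with
  | h0 => rw [map_zero]; exact Submodule.zero_mem _
  | hadd f g hf hg =>
    rw [map_add]
    exact Submodule.add_mem _ (hf trivial) (hg trivial)
  | hmon p a =>
    by_cases hp : n + r.length ≤ p.length
    · rw [Ideal.Quotient.eq_zero_iff_mem.mpr (monomial_mem_ideal k R hr hp a)]
      exact Submodule.zero_mem _
    · have hs : Ideal.Quotient.mk (R.ideal k) (PathAlgebra.monomial p 1) ∈ s := by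
        refine Finset.mem_image.mpr ⟨(p.source, p.length), ?_, rfl⟩
        simp only [Finset.mem_product, Finset.mem_univ, Finset.mem_range, true_and]
        omega
      have := Submodule.smul_mem _ a (Submodule.subset_span (R := k) (Finset.mem_coe.mpr hs))
      have h2 : a • Ideal.Quotient.mk (R.ideal k) (PathAlgebra.monomial p 1) =
          Ideal.Quotient.mk (R.ideal k) (PathAlgebra.monomial p a) := by
        conv_rhs => rw [← mul_one a, ← PathAlgebra.smul_monomial]
        rfl
      rwa [h2] at this

instance : IsArtinianRing (NakayamaAlgebra k R) :=
  IsArtinianRing.of_finite k _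

end NakayamaAlgebra

end

/-! ### Syzygies, projective dimension and the `φ`-function over an Artinian ring. -/

noncomputable section

namespace Homological

variable {A : Type u} [Ring A]

/-! ### Uniqueness of projective covers -/

/-! Lift the cyclic quiver to its universal cover `ℤ`. Every module is a finite direct sum of
uniserial modules (`induction_on_modules`), and a uniserial module is an interval `[a, b)`, listing
its composition factors from top to socle. Put `f i = i + c i`, where `c i` is the length of the
projective with top `i`; this is `CyclicGenerators.succ`. It is monotone, commutes with translation
by `n` and satisfies `f i ≥ i + 2`. The projectives are the intervals `[a, f a)`, and `Ω [a, b) =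
[b, f a)`, so `Ω² [a, b) = [f a, f b)` as long as `[a, b)` is nonzero and not projective. All
invariants can therefore be read off from `f`.

Modulo `n`, let `T` be the set of values of `f`, and `S` the set of points of increase, where `f (a
- 1) ≠ f a`. Each fibre of `f` has exactly one first point, so `S` and `T` have the same cardinality
(`Monotone.exists_finsets_card_eq`). Now `findim ≤ 0` says that `S` is everything and `del ≤ 0` that
`T` is everything, while `findim ≤ 1` says `T ⊆ S` and `del ≤ 1` says `S ⊆ T`. By equality of
cardinalities both pairs of conditions are equivalent, with no assumption on the `φ`-dimension.

The hypothesis enters only for the bound two. A module of finite projective dimension spans a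
subgroup of `K₀` that some power of `L` kills, so `φ ≤ 2` makes its second syzygy projective
(`projective_syzygy_of_phi_le`); hence `findim ≤ 2`. In terms of `f`, this makes `f` injective on
its image, hence, by finiteness modulo `n`, surjective from its image to itself. That surjectivity
exhibits `Ω² S`, for `S` simple, as zero, projective or a third syzygy (`del_le_two`), so `del ≤ 2`.
Comparing the bounds zero, one and two on both sides gives the two equivalences. -/

/-- If `N` and the image of `K` span `Q`, then the preimage of `N` and `K` span `P`, so the preimage
is all of `P` and `N` already contains the image of `K`. Applied to the two inclusions, it shows
that a product of projective covers is a projective cover. -/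
theorem superfluous_map {P Q : Type u} [AddCommGroup P] [Module A P] [AddCommGroup Q] [Module A Q]
    (f : P →ₗ[A] Q) {K : Submodule A P} (hK : ∀ N : Submodule A P, N ⊔ K = ⊤ → N = ⊤)
    (N : Submodule A Q) (hN : N ⊔ K.map f = ⊤) : N = ⊤ := by
  have h : N.comap f = ⊤ := by
    refine hK _ (eq_top_iff.mpr fun p _ => ?_)
    have hp : f p ∈ N ⊔ K.map f := hN ▸ Submodule.mem_top
    obtain ⟨y, hy, z, ⟨x, hx, rfl⟩, hyz⟩ := Submodule.mem_sup.mp hp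
    refine Submodule.mem_sup.mpr ⟨p - x, ?_, x, hx, sub_add_cancel p x⟩
    rw [Submodule.mem_comap, map_sub, ← hyz, add_sub_cancel_right]
    exact hy
  rw [← hN, eq_comm, sup_eq_left, Submodule.map_le_iff_le_comap, h]
  exact le_top

theorem IsProjectiveCover.prodMap {P M Q N : FGModuleCat.{u} A} {π : P →ₗ[A] M} {ρ : Q →ₗ[A] N}
    (hπ : IsProjectiveCover π) (hρ : IsProjectiveCover ρ) :
    IsProjectiveCover (P := FGModuleCat.of A (P × Q)) (M := FGModuleCat.of A (M × N))
      (π.prodMap ρ) where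
  projective := by
    have := hπ.projective
    have := hρ.projective
    exact inferInstanceAs (Module.Projective A (P × Q))
  surjective := Function.Surjective.prodMap hπ.surjective hρ.surjective
  superfluous := fun K hK => by
    have hk : LinearMap.ker (π.prodMap ρ) =
        (LinearMap.ker π).map (LinearMap.inl A P Q) ⊔
          (LinearMap.ker ρ).map (LinearMap.inr A P Q) := by
      rw [LinearMap.ker_prodMap]
      rw [Submodule.map_inl, Submodule.map_inr, Submodule.prod_sup_prod, sup_bot_eq, bot_sup_eq]
    rw [hk, ← sup_assoc] at hK
    exact superfluous_map _ hπ.superfluous _ (superfluous_map _ hρ.superfluous _ hK)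

theorem isProjectiveCover_id {P : FGModuleCat.{u} A} (hP : Module.Projective A P) :
    IsProjectiveCover (LinearMap.id : P →ₗ[A] P) where
  projective := hP
  surjective := Function.surjective_id
  superfluous := fun N hN => by rwa [LinearMap.ker_id, sup_bot_eq] at hN

theorem IsProjectiveCover.comp_equiv {P M N : FGModuleCat.{u} A} {π : P →ₗ[A] M}
    (hπ : IsProjectiveCover π) (e : M ≃ₗ[A] N) : IsProjectiveCover (e.toLinearMap ∘ₗ π) where
  projective := hπ.projective
  surjective := e.surjective.comp hπ.surjective
  superfluous := by rw [LinearEquiv.ker_comp]; exact hπ.superfluous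

/-- Lifts between projective covers are surjective. -/
theorem IsProjectiveCover.surjective_lift {P Q M : FGModuleCat.{u} A} {π : P →ₗ[A] M}
    {ρ : Q →ₗ[A] M} (hρ : IsProjectiveCover ρ) (hπ : Function.Surjective π) {g : P →ₗ[A] Q}
    (hg : ∀ x, ρ (g x) = π x) : Function.Surjective g := by
  rw [← LinearMap.range_eq_top]
  refine hρ.superfluous _ (eq_top_iff.mpr fun q _ => ?_)
  obtain ⟨p, hp⟩ := hπ (ρ q)
  refine Submodule.mem_sup.mpr ⟨g p, ⟨p, rfl⟩, q - g p, ?_, by abel⟩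
  rw [LinearMap.mem_ker, map_sub, hg, hp, sub_self]

section Syzygy

variable [IsArtinianRing A]

/-- Lifts in both directions are surjective because the kernels are superfluous; their composite is
a surjective endomorphism of a Noetherian module, hence injective, and the lift restricts to the
kernels. -/
theorem IsProjectiveCover.nonempty_ker_equiv {P Q M : FGModuleCat.{u} A} {π : P →ₗ[A] M}
    {ρ : Q →ₗ[A] M} (hπ : IsProjectiveCover π) (hρ : IsProjectiveCover ρ) :
    Nonempty (LinearMap.ker π ≃ₗ[A] LinearMap.ker ρ) := by
  have := hπ.projective
  have := hρ.projective
  obtain ⟨g, hg⟩ := Module.projective_lifting_property ρ π hρ.surjective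
  obtain ⟨h, hh⟩ := Module.projective_lifting_property π ρ hπ.surjective
  have hg' : ∀ x, ρ (g x) = π x := fun x => LinearMap.congr_fun hg x
  have hh' : ∀ x, π (h x) = ρ x := fun x => LinearMap.congr_fun hh x
  have gs := hρ.surjective_lift hπ.surjective hg'
  have hs := hπ.surjective_lift hρ.surjective hh'
  have hi : Function.Injective (h ∘ₗ g) :=
    IsNoetherian.injective_of_surjective_endomorphism _ (hs.comp gs)
  have gi : Function.Injective g := Function.Injective.of_comp (f := h) hi
  let e := LinearEquiv.ofBijective g ⟨gi, gs⟩
  refine ⟨LinearEquiv.ofSubmodules e _ _ ?_⟩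
  ext q
  obtain ⟨p, rfl⟩ := e.surjective q
  simp only [Submodule.mem_map, LinearMap.mem_ker]
  constructor
  · rintro ⟨x, hx, hxp⟩
    rw [← hxp]
    exact (hg' x).trans hx
  · intro hp
    exact ⟨p, (hg' p).symm.trans hp, rfl⟩

theorem IsProjectiveCover.nonempty_syzygy_equiv {P M : FGModuleCat.{u} A} {π : P →ₗ[A] M}
    (hπ : IsProjectiveCover π) : Nonempty (syzygy M ≃ₗ[A] LinearMap.ker π) :=
  (isProjectiveCover_coverMap M).nonempty_ker_equiv hπ

theorem nonempty_syzygy_congr {M N : FGModuleCat.{u} A} (e : M ≃ₗ[A] N) :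
    Nonempty (syzygy M ≃ₗ[A] syzygy N) := by
  obtain ⟨e'⟩ := ((isProjectiveCover_coverMap M).comp_equiv e).nonempty_syzygy_equiv
  exact ⟨((LinearEquiv.ofEq _ _ (LinearEquiv.ker_comp e _)).symm.trans e'.symm)⟩

theorem nonempty_syzygy_prod {X Y Z : FGModuleCat.{u} A} (e : Z ≃ₗ[A] X × Y) :
    Nonempty (syzygy Z ≃ₗ[A] syzygy X × syzygy Y) := by
  have hXY := (isProjectiveCover_coverMap X).prodMap (isProjectiveCover_coverMap Y)
  obtain ⟨e₁⟩ := nonempty_syzygy_congr (M := Z) (N := FGModuleCat.of A (X × Y)) e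
  obtain ⟨e₂⟩ := hXY.nonempty_syzygy_equiv
  refine ⟨e₁.trans (e₂.trans ((LinearEquiv.ofEq _ _ (LinearMap.ker_prodMap _ _)).trans
    { toFun := fun z => (⟨z.1.1, z.2.1⟩, ⟨z.1.2, z.2.2⟩)
      map_add' := fun _ _ => rfl
      map_smul' := fun _ _ => rfl
      invFun := fun w => ⟨(w.1.1, w.2.1), w.1.2, w.2.2⟩
      left_inv := fun _ => rfl
      right_inv := fun _ => rfl }))⟩

theorem nonempty_syzygy_iterate_prod {X Y Z : FGModuleCat.{u} A} (e : Z ≃ₗ[A] X × Y) (t : ℕ) :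
    Nonempty ((syzygy^[t] Z : FGModuleCat.{u} A) ≃ₗ[A]
      (syzygy^[t] X : FGModuleCat.{u} A) × (syzygy^[t] Y : FGModuleCat.{u} A)) := by
  induction t generalizing X Y Z with
  | zero => exact ⟨e⟩
  | succ t ih =>
    obtain ⟨e'⟩ := nonempty_syzygy_prod e
    exact ih e'

theorem subsingleton_syzygy {P : FGModuleCat.{u} A} (hP : Module.Projective A P) :
    Subsingleton (syzygy P) := by
  obtain ⟨e⟩ := (isProjectiveCover_id hP).nonempty_syzygy_equiv
  have : Subsingleton (LinearMap.ker (LinearMap.id : P →ₗ[A] P)) := by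
    rw [LinearMap.ker_id]; infer_instance
  exact e.toEquiv.subsingleton

theorem projective_of_subsingleton_syzygy {M : FGModuleCat.{u} A} (h : Subsingleton (syzygy M)) :
    Module.Projective A M := by
  have hc := isProjectiveCover_coverMap M
  have := hc.projective
  have hi : Function.Injective (coverMap M) := by
    rw [← LinearMap.ker_eq_bot]
    exact Submodule.subsingleton_iff_eq_bot.mp h
  exact Module.Projective.of_equiv (LinearEquiv.ofBijective _ ⟨hi, hc.surjective⟩)

theorem projective_syzygy {M : FGModuleCat.{u} A} (h : Module.Projective A M) :
    Module.Projective A (syzygy M) := by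
  have := subsingleton_syzygy h
  infer_instance

theorem projective_syzygy_iterate_mono {M : FGModuleCat.{u} A} {s t : ℕ} (hst : s ≤ t)
    (h : Module.Projective A (syzygy^[s] M : FGModuleCat.{u} A)) :
    Module.Projective A (syzygy^[t] M : FGModuleCat.{u} A) := by
  induction t, hst using Nat.le_induction with
  | base => exact h
  | succ t _ ih =>
    rw [Function.iterate_succ_apply']
    exact projective_syzygy ih

theorem projective_syzygy_iterate_of_equiv_prod {X Y Z : FGModuleCat.{u} A} (e : Z ≃ₗ[A] X × Y)
    (t : ℕ) : Module.Projective A (syzygy^[t] Z : FGModuleCat.{u} A) ↔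
      Module.Projective A (syzygy^[t] X : FGModuleCat.{u} A) ∧
        Module.Projective A (syzygy^[t] Y : FGModuleCat.{u} A) := by
  obtain ⟨e'⟩ := nonempty_syzygy_iterate_prod e t
  constructor
  · intro h
    have : Module.Projective A
        ((syzygy^[t] X : FGModuleCat.{u} A) × (syzygy^[t] Y : FGModuleCat.{u} A)) :=
      Module.Projective.of_equiv e'
    exact ⟨Module.Projective.of_split
        (LinearMap.inl A (syzygy^[t] X : FGModuleCat.{u} A) (syzygy^[t] Y : FGModuleCat.{u} A))
        (LinearMap.fst A _ _) (LinearMap.fst_comp_inl ..),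
      Module.Projective.of_split
        (LinearMap.inr A (syzygy^[t] X : FGModuleCat.{u} A) (syzygy^[t] Y : FGModuleCat.{u} A))
        (LinearMap.snd A _ _) (LinearMap.snd_comp_inr ..)⟩
  · rintro ⟨h₁, h₂⟩
    exact Module.Projective.of_equiv e'.symm

end Syzygy

/-! ### Direct summands -/

theorem IsDirectSummand.trans {N X Y : Type u} [AddCommGroup N] [Module A N] [AddCommGroup X]
    [Module A X] [AddCommGroup Y] [Module A Y] (h : IsDirectSummand (A := A) N X)
    (h' : IsDirectSummand (A := A) X Y) : IsDirectSummand (A := A) N Y := by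
  obtain ⟨i, p, hip⟩ := h
  obtain ⟨j, q, hjq⟩ := h'
  refine ⟨j ∘ₗ i, p ∘ₗ q, ?_⟩
  rw [LinearMap.comp_assoc, ← LinearMap.comp_assoc i, hjq, LinearMap.id_comp, hip]

theorem IsDirectSummand.of_equiv {N X : Type u} [AddCommGroup N] [Module A N] [AddCommGroup X]
    [Module A X] (e : N ≃ₗ[A] X) : IsDirectSummand (A := A) N X :=
  ⟨e.toLinearMap, e.symm.toLinearMap, by ext; simp⟩

theorem IsDirectSummand.prod_left {N X Y : Type u} [AddCommGroup N] [Module A N] [AddCommGroup X]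
    [Module A X] [AddCommGroup Y] [Module A Y] (h : IsDirectSummand (A := A) N X) :
    IsDirectSummand (A := A) N (X × Y) :=
  h.trans ⟨LinearMap.inl A X Y, LinearMap.fst A X Y, LinearMap.fst_comp_inl ..⟩

theorem IsDirectSummand.prod_right {N X Y : Type u} [AddCommGroup N] [Module A N]
    [AddCommGroup X] [Module A X] [AddCommGroup Y] [Module A Y]
    (h : IsDirectSummand (A := A) N Y) : IsDirectSummand (A := A) N (X × Y) :=
  h.trans ⟨LinearMap.inr A X Y, LinearMap.snd A X Y, LinearMap.snd_comp_inr ..⟩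

theorem IsDirectSummand.exists_equiv_prod {N X : Type u} [AddCommGroup N] [Module A N]
    [AddCommGroup X] [Module A X] (h : IsDirectSummand (A := A) N X) :
    ∃ K : Submodule A X, Nonempty (X ≃ₗ[A] N × K) := by
  obtain ⟨i, p, hip⟩ := h
  have hp : ∀ y, p (i y) = y := fun y => LinearMap.congr_fun hip y
  refine ⟨LinearMap.ker p, ⟨
    { toFun := fun x => (p x, ⟨x - i (p x), by simp [hp]⟩)
      map_add' := fun x y => by
        ext
        · simp
        · simp only [map_add, Prod.mk_add_mk, AddMemClass.mk_add_mk]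
          abel
      map_smul' := fun a x => by ext <;> simp [smul_sub]
      invFun := fun w => i w.1 + w.2.1
      left_inv := fun x => by simp
      right_inv := fun w => by
        have := LinearMap.mem_ker.mp w.2.2
        ext <;> simp [hp, this] }⟩⟩

section Syzygy

variable [IsArtinianRing A]

theorem projective_syzygy_iterate_of_isDirectSummand {X Z : FGModuleCat.{u} A}
    (h : IsDirectSummand (A := A) X Z) {t : ℕ}
    (hZ : Module.Projective A (syzygy^[t] Z : FGModuleCat.{u} A)) :
    Module.Projective A (syzygy^[t] X : FGModuleCat.{u} A) := by
  obtain ⟨K, ⟨e⟩⟩ := h.exists_equiv_prod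
  exact ((projective_syzygy_iterate_of_equiv_prod (Y := FGModuleCat.of A K) e t).mp hZ).1

theorem projective_syzygy_iterate_pi {M : FGModuleCat.{u} A} {t : ℕ}
    (hM : Module.Projective A (syzygy^[t] M : FGModuleCat.{u} A)) (m : ℕ) :
    Module.Projective A (syzygy^[t] (FGModuleCat.of A (Fin m → M)) : FGModuleCat.{u} A) := by
  induction m with
  | zero =>
    have h : Module.Projective A (FGModuleCat.of A (Fin 0 → M)) :=
      inferInstanceAs (Module.Projective A (Fin 0 → M))
    exact projective_syzygy_iterate_mono (s := 0) (Nat.zero_le t) h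
  | succ m ih =>
    exact (projective_syzygy_iterate_of_equiv_prod (X := M) (Y := FGModuleCat.of A (Fin m → M))
      (Z := FGModuleCat.of A (Fin (m + 1) → M)) (Fin.consLinearEquiv A fun _ => M).symm t).mpr
      ⟨hM, ih⟩

/-! ### Projective dimension by syzygies -/

/-- Dimension shift along `0 → Ω M → P → M → 0`. It turns the categorical projective dimension into
a condition on iterated syzygies. -/
theorem hasProjectiveDimensionLT_succ_iff (M : FGModuleCat.{u} A) (t : ℕ) :
    HasProjectiveDimensionLT M.obj (t + 1) ↔
      Module.Projective A (syzygy^[t] M : FGModuleCat.{u} A) := by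
  induction t generalizing M with
  | zero =>
    rw [zero_add, ← projective_iff_hasProjectiveDimensionLT_one]
    exact (IsProjective.iff_projective (M : Type u)).symm
  | succ t ih =>
    have hc := isProjectiveCover_coverMap M
    have hP : Projective (coverModule M).obj :=
      (IsProjective.iff_projective (coverModule M : Type u)).mp hc.projective
    have hS := LinearMap.shortExact_shortComplexKer hc.surjective
    exact (hS.hasProjectiveDimensionLT_X₃_iff t hP).trans (ih (syzygy M))

/-- Finite projective dimensions have no gaps: a module of finite projective dimension above `d` has
a syzygy of projective dimension exactly `d + 1`. Hence it suffices to exclude `d + 1`. -/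
theorem findim_le_iff (d : ℕ) :
    findim A ≤ d ↔ ∀ M : FGModuleCat.{u} A,
      Module.Projective A (syzygy^[d + 1] M : FGModuleCat.{u} A) →
        Module.Projective A (syzygy^[d] M : FGModuleCat.{u} A) := by
  simp only [findim, iSup_le_iff, projectiveDimension_ne_top_iff, projectiveDimension_le_iff]
  constructor
  · intro h M hM
    rw [← hasProjectiveDimensionLT_succ_iff] at hM ⊢
    exact h M ⟨_, hM⟩
  · rintro h M ⟨m, hm⟩
    have key : ∀ t, Module.Projective A (syzygy^[d + t] M : FGModuleCat.{u} A) →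
        Module.Projective A (syzygy^[d] M : FGModuleCat.{u} A) := by
      intro t
      induction t with
      | zero => exact id
      | succ t ih =>
        intro ht
        refine ih ?_
        rw [Function.iterate_add_apply]
        refine h _ ?_
        rw [← Function.iterate_add_apply]
        rwa [show d + 1 + t = d + (t + 1) by omega]
    refine (hasProjectiveDimensionLT_succ_iff M d).mpr (key m ?_)
    rw [← hasProjectiveDimensionLT_succ_iff]
    exact hasProjectiveDimensionLT_of_ge M.obj (m + 1) _ (by omega)

/-! ### The `φ`-dimension bounds projective dimensions -/

variable (A) in
/-- The additive function on `K₀` sending `[M]` to the length of `Ω M`. -/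
def syzygyLength : K0 A →+ ℤ :=
  QuotientAddGroup.lift _
    (FreeAbelianGroup.lift fun M : FGModuleCat.{u} A =>
      ((Module.length A (syzygy M)).toNat : ℤ)) (by
    rw [AddSubgroup.closure_le]
    rintro c (⟨X, Y, Z, ⟨e⟩, rfl⟩ | ⟨P, hP, rfl⟩)
    · obtain ⟨e'⟩ := nonempty_syzygy_prod e
      simp only [SetLike.mem_coe, AddMonoidHom.mem_ker, map_sub, map_add,
        FreeAbelianGroup.lift_apply_of]
      rw [e'.length_eq, Module.length_prod,
        ENat.toNat_add Module.length_ne_top Module.length_ne_top, Nat.cast_add, sub_self]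
    · have := subsingleton_syzygy hP
      simp only [SetLike.mem_coe, AddMonoidHom.mem_ker, FreeAbelianGroup.lift_apply_of]
      rw [Module.length_eq_zero]
      rfl)

theorem syzygyLength_mk (M : FGModuleCat.{u} A) :
    syzygyLength A (K0.mk M) = ((Module.length A (syzygy M)).toNat : ℤ) :=
  FreeAbelianGroup.lift_apply_of _ _

/-- The length of the syzygy is additive on `K₀` with values in the torsion-free group `ℤ`, and
vanishes only on projectives. So a nonprojective module has a class of infinite order, and no
Krull–Schmidt theorem is needed to see it. -/
theorem projective_of_zsmul_mk_eq_zero {M : FGModuleCat.{u} A} {a : ℤ} (ha : a ≠ 0)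
    (h : a • K0.mk M = 0) : Module.Projective A M := by
  have h' := congrArg (syzygyLength A) h
  rw [map_zsmul, syzygyLength_mk, map_zero, smul_eq_mul, mul_eq_zero, or_iff_right ha,
    Nat.cast_eq_zero, ENat.toNat_eq_zero, or_iff_left Module.length_ne_top] at h'
  exact projective_of_subsingleton_syzygy (Module.length_eq_zero_iff.mp h')

theorem L_pow_mk (M : FGModuleCat.{u} A) (t : ℕ) :
    (L A ^ t : AddMonoid.End (K0 A)) (K0.mk M) = K0.mk (syzygy^[t] M) := by
  induction t generalizing M with
  | zero => rfl
  | succ t ih => rw [pow_succ, AddMonoid.End.coe_mul, Function.comp_apply, L_mk, ih]; rfl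

theorem map_L_pow_addSubgroup_eq_bot {M : FGModuleCat.{u} A} {t : ℕ}
    (hM : Module.Projective A (syzygy^[t] M : FGModuleCat.{u} A)) :
    (addSubgroup M).map (L A ^ t : AddMonoid.End (K0 A)) = ⊥ := by
  refine eq_bot_iff.mpr (AddSubgroup.map_le_iff_le_comap.mpr ?_)
  rw [addSubgroup, AddSubgroup.closure_le]
  rintro _ ⟨X, ⟨m, hm⟩, rfl⟩
  refine AddSubgroup.mem_comap.mpr (AddSubgroup.mem_bot.mpr ?_)
  refine (L_pow_mk X t).trans (K0.mk_eq_zero ?_)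
  exact projective_syzygy_iterate_of_isDirectSummand (Z := FGModuleCat.of A (Fin m → M)) hm
    (projective_syzygy_iterate_pi hM m)

/-- If `φ(M) ≤ d` then `Ω^d M` is projective as soon as `M` has finite projective dimension. -/
theorem projective_syzygy_of_phi_le {M : FGModuleCat.{u} A} {d s : ℕ} (hphi : phi M ≤ d)
    (hM : Module.Projective A (syzygy^[s] M : FGModuleCat.{u} A)) :
    Module.Projective A (syzygy^[d] M : FGModuleCat.{u} A) := by
  have hlt : phi M < ((d + 1 : ℕ) : ℕ∞) := hphi.trans_lt (by exact_mod_cast d.lt_succ_self)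
  obtain ⟨_, ⟨t, rfl, ht⟩, htd⟩ := sInf_lt_iff.mp hlt
  have htd : t ≤ d := Nat.lt_succ_iff.mp (by exact_mod_cast htd)
  -- The shift by `s + 1` reaches an exponent at which `L` has killed `⟨add M⟩`, and meets the
  -- requirement `1 ≤ j` even when `s = 0`.
  have hr := ht (s + 1) (by omega)
  have h0 : rankL M (t + (s + 1)) = 0 := by
    have hb := map_L_pow_addSubgroup_eq_bot
      (projective_syzygy_iterate_mono (show s ≤ t + (s + 1) by omega) hM)
    have : Subsingleton
        ((addSubgroup M).map (L A ^ (t + (s + 1)) : AddMonoid.End (K0 A))) := by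
      rw [hb]; infer_instance
    exact rank_subsingleton' ..
  -- Rank zero means that every element is torsion; this is applied to the class of `Ω^t M`.
  rw [h0, rankL, rank_eq_zero_iff] at hr
  have hmem : K0.mk M ∈ addSubgroup M :=
    AddSubgroup.subset_closure ⟨M, ⟨1, LinearMap.pi fun _ => LinearMap.id,
      LinearMap.proj 0, rfl⟩, rfl⟩
  obtain ⟨a, ha, hz⟩ := hr ⟨_, AddSubgroup.mem_map_of_mem _ hmem⟩
  have hz' := congrArg Subtype.val hz
  have hz'' : a • K0.mk (syzygy^[t] M) = 0 := by
    rw [← L_pow_mk]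
    exact hz'
  exact projective_syzygy_iterate_mono htd (projective_of_zsmul_mk_eq_zero ha hz'')

theorem projective_syzygy_of_phiDim_le {d : ℕ} (hphi : phiDim A ≤ d) {M : FGModuleCat.{u} A}
    {s : ℕ} (hM : Module.Projective A (syzygy^[s] M : FGModuleCat.{u} A)) :
    Module.Projective A (syzygy^[d] M : FGModuleCat.{u} A) :=
  projective_syzygy_of_phi_le ((le_iSup phi M).trans hphi) hM

theorem delModule_le_iff (M : FGModuleCat.{u} A) (d : ℕ) :
    delModule M ≤ d ↔ ∃ t ≤ d, ∃ M' : FGModuleCat.{u} A,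
      IsDirectSummand (A := A) (syzygy^[t] M) (A × (syzygy^[t + 1] M' : FGModuleCat.{u} A)) := by
  constructor
  · intro h
    have hlt : delModule M < ((d + 1 : ℕ) : ℕ∞) := h.trans_lt (by exact_mod_cast d.lt_succ_self)
    obtain ⟨_, ⟨t, rfl, ht⟩, htd⟩ := sInf_lt_iff.mp hlt
    exact ⟨t, Nat.lt_succ_iff.mp (by exact_mod_cast htd), ht⟩
  · rintro ⟨t, htd, ht⟩
    have hle : delModule M ≤ t := sInf_le ⟨t, rfl, ht⟩
    exact hle.trans (by exact_mod_cast htd)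

end Syzygy

end Homological

end

/-! ### Algebras generated by cyclically permuted idempotents and a nilpotent element. -/

noncomputable section

open Polynomial in
/-- A system of generators of a cyclic Nakayama algebra: orthogonal idempotents `e i` with sum `1`
and a nilpotent element `x`, the sum of the arrows, which generate `Λ`. -/
structure CyclicGenerators (k Λ : Type u) [Field k] [Ring Λ] [Algebra k Λ] (n : ℕ) [NeZero n] where
  e : ZMod n → Λ
  x : Λ
  sum_e : ∑ i, e i = 1
  e_mul_self : ∀ i, e i * e i = e i
  e_mul_e : ∀ i j, i ≠ j → e i * e j = 0
  x_mul_e : ∀ i, x * e i = e (i + 1) * x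
  exists_mul_e : ∀ (r : Λ) (i : ZMod n), ∃ p : k[X], r * e i = aeval x p * e i
  isNilpotent_x : IsNilpotent x
  x_mul_e_ne_zero : ∀ i, x * e i ≠ 0

namespace CyclicGenerators

open Polynomial Homological

variable {k Λ : Type u} [Field k] [Ring Λ] [Algebra k Λ] {n : ℕ} [NeZero n]
  (D : CyclicGenerators k Λ n)

theorem x_pow_mul_e (s : ℕ) (i : ZMod n) : D.x ^ s * D.e i = D.e (i + s) * D.x ^ s := by
  induction s with
  | zero => simp
  | succ s ih =>
    rw [pow_succ', mul_assoc, ih, ← mul_assoc, D.x_mul_e, mul_assoc, Nat.cast_succ, add_assoc]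

/-- The left-right mirror of the field `exists_mul_e`: on `aeval D.x p * D.e i`, left multiplication
by `D.e b` keeps just the monomials of `p` whose paths from `i` end at `b`. -/
theorem exists_e_mul (r : Λ) (b : ZMod n) : ∃ q : k[X], D.e b * r = D.e b * aeval D.x q := by
  have key : ∀ (p : k[X]) (i : ZMod n),
      ∃ q : k[X], D.e b * (aeval D.x p * D.e i) = D.e b * aeval D.x q := by
    intro p i
    induction p using Polynomial.induction_on' with
    | add p₁ p₂ h₁ h₂ =>
      obtain ⟨q₁, h₁⟩ := h₁
      obtain ⟨q₂, h₂⟩ := h₂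
      exact ⟨q₁ + q₂, by simp only [map_add, add_mul, mul_add, h₁, h₂]⟩
    | monomial s c =>
      by_cases h : b = i + s
      · refine ⟨monomial s c, ?_⟩
        rw [aeval_monomial, mul_assoc, D.x_pow_mul_e, ← h, ← mul_assoc (algebraMap k Λ c),
          Algebra.commutes, mul_assoc, ← mul_assoc (D.e b), D.e_mul_self, Algebra.commutes]
      · refine ⟨0, ?_⟩
        rw [aeval_monomial, mul_assoc, D.x_pow_mul_e, ← mul_assoc (algebraMap k Λ c),
          Algebra.commutes, mul_assoc, ← mul_assoc (D.e b), D.e_mul_e _ _ h]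
        simp
  choose p hp using fun i => D.exists_mul_e r i
  choose q hq using fun i => key (p i) i
  refine ⟨∑ i, q i, ?_⟩
  rw [map_sum, Finset.mul_sum]
  simp only [← hq, ← hp]
  rw [← Finset.mul_sum, ← Finset.mul_sum, D.sum_e, mul_one]

/-! ### Polynomials in `x` acting on a vector. -/

section Smul

variable {M : Type u} [AddCommGroup M] [Module Λ M]

/-- Write `p = X ^ i * q` with `q` of nonzero constant term `c`. Since `x ^ l` kills `m`,
multiplying by `x ^ (l - 1 - i)` leaves only `c` times `x ^ (l - 1) • m`. Thus every nonzero element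
of a uniserial module can be pushed to a nonzero multiple of the socle generator. -/
theorem exists_pow_smul_eq {m : M} {l : ℕ} (hl : D.x ^ l • m = 0) {p : k[X]}
    (hp : aeval D.x p • m ≠ 0) :
    ∃ (j : ℕ) (c : k), c ≠ 0 ∧
      D.x ^ j • aeval D.x p • m = algebraMap k Λ c • D.x ^ (l - 1) • m := by
  classical
  have hp0 : p ≠ 0 := by
    rintro rfl
    simp at hp
  obtain ⟨i, q, hq, hd⟩ : ∃ (i : ℕ) (q : k[X]), p = X ^ i * q ∧ ¬ X ∣ q := by
    obtain ⟨q, hq, hd⟩ := Polynomial.exists_eq_pow_rootMultiplicity_mul_and_not_dvd p hp0 0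
    rw [C_0, sub_zero] at hq hd
    exact ⟨_, q, hq, hd⟩
  have hi : i < l := by
    by_contra hi
    apply hp
    rw [hq, mul_comm, ← Nat.sub_add_cancel (not_lt.mp hi), pow_add, map_mul, map_mul, aeval_X_pow,
      aeval_X_pow, mul_smul, mul_smul, hl, smul_zero, smul_zero]
  refine ⟨l - 1 - i, q.coeff 0, fun h => hd (X_dvd_iff.mpr h), ?_⟩
  have h₁ : D.x ^ (l - 1 - i) * aeval D.x p = aeval D.x (q * X ^ (l - 1)) := by
    rw [hq, ← aeval_X_pow (R := k) D.x, ← map_mul, ← mul_assoc, ← pow_add, mul_comm,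
      Nat.sub_add_cancel (by omega)]
  have h₂ : q * X ^ (l - 1) = q.divX * X ^ l + C (q.coeff 0) * X ^ (l - 1) := by
    conv_lhs => rw [← divX_mul_X_add q]
    rw [add_mul, mul_assoc, ← pow_succ', Nat.sub_add_cancel (by omega)]
  rw [← mul_smul, h₁, h₂, map_add, map_mul, map_mul, aeval_X_pow, aeval_X_pow, aeval_C, add_smul,
    mul_smul, mul_smul, hl, smul_zero, zero_add]

theorem algebraMap_smul_eq_zero {c : k} (hc : c ≠ 0) {v : M} (h : algebraMap k Λ c • v = 0) :
    v = 0 := by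
  have h' : algebraMap k Λ c⁻¹ • algebraMap k Λ c • v = 0 := by rw [h, smul_zero]
  rwa [← mul_smul, ← map_mul, inv_mul_cancel₀ hc, map_one, one_smul] at h'

/-- If the lowest nonzero coefficient of `p` had degree `d < l`, multiplying by `x ^ (l - d - 1)`
would isolate a nonzero multiple of `x ^ (l - 1) • m`, which does not vanish. -/
theorem aeval_smul_eq_zero_iff {m : M} {l : ℕ} (hl : ∀ s, D.x ^ s • m = 0 ↔ l ≤ s) (p : k[X]) :
    aeval D.x p • m = 0 ↔ X ^ l ∣ p := by
  constructor
  · intro h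
    rw [X_pow_dvd_iff]
    intro d
    induction d using Nat.strong_induction_on with
    | _ d ih =>
      intro hd
      have hX : X ^ d ∣ p := X_pow_dvd_iff.mpr fun j hj => ih j hj (hj.trans hd)
      obtain ⟨q, rfl⟩ := hX
      by_contra hc
      have h0 : D.x ^ (d + 1) • (D.x ^ (l - d - 1) • m) = 0 := by
        rw [← mul_smul, ← pow_add]
        exact (hl _).mpr (by omega)
      have h1 : aeval D.x (X ^ d * q) • D.x ^ (l - d - 1) • m = 0 := by
        rw [← aeval_X_pow (R := k) D.x, ← mul_smul, ← map_mul, mul_comm, map_mul, mul_smul, h,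
          smul_zero]
      have h2 : X ^ d * q = q.divX * X ^ (d + 1) + C (q.coeff 0) * X ^ d := by
        conv_lhs => rw [← divX_mul_X_add q]
        ring
      rw [h2, map_add, map_mul, map_mul, aeval_X_pow, aeval_X_pow, aeval_C, add_smul, mul_smul,
        h0, smul_zero, zero_add, mul_smul] at h1
      rw [coeff_X_pow_mul', if_pos le_rfl, Nat.sub_self] at hc
      have h3 := algebraMap_smul_eq_zero hc h1
      rw [← mul_smul, ← pow_add, hl] at h3
      omega
  · rintro ⟨q, rfl⟩
    rw [mul_comm, map_mul, aeval_X_pow, mul_smul, (hl l).mpr le_rfl, smul_zero]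

/-- `m` generates a uniserial module of length `l` with top at the vertex `a`. -/
structure IsGenerator (m : M) (a : ZMod n) (l : ℕ) : Prop where
  e_smul : D.e a • m = m
  exists_eq : ∀ v : M, ∃ p : k[X], v = aeval D.x p • m
  pow_smul_eq_zero_iff : ∀ s, D.x ^ s • m = 0 ↔ l ≤ s

theorem exists_smul_eq {m : M} {a : ZMod n} (ha : D.e a • m = m) (r : Λ) :
    ∃ p : k[X], r • m = aeval D.x p • m := by
  obtain ⟨p, hp⟩ := D.exists_mul_e r a
  refine ⟨p, ?_⟩
  conv_lhs => rw [← ha]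
  rw [← mul_smul, hp, mul_smul, ha]

end Smul

/-- `M` is uniserial of length `l`, with top at the vertex `a`. -/
def IsUniserial (M : Type u) [AddCommGroup M] [Module Λ M] (a : ZMod n) (l : ℕ) : Prop :=
  ∃ m : M, D.IsGenerator m a l

/-! ### Classification of uniserial modules and their direct summands. -/

section Uniserial

variable {D} {M N : Type u} [AddCommGroup M] [Module Λ M] [AddCommGroup N] [Module Λ N]
  {a a' : ZMod n} {l l' : ℕ}

theorem IsGenerator.map {m : M} (h : D.IsGenerator m a l) (f : M ≃ₗ[Λ] N) :
    D.IsGenerator (f m) a l where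
  e_smul := by rw [← map_smul, h.e_smul]
  exists_eq := fun v => by
    obtain ⟨p, hp⟩ := h.exists_eq (f.symm v)
    exact ⟨p, by rw [← map_smul, ← hp, f.apply_symm_apply]⟩
  pow_smul_eq_zero_iff := fun s => by
    rw [← map_smul, f.map_eq_zero_iff, h.pow_smul_eq_zero_iff]

theorem IsUniserial.congr (h : D.IsUniserial M a l) (f : M ≃ₗ[Λ] N) : D.IsUniserial N a l := by
  obtain ⟨m, hm⟩ := h
  exact ⟨f m, hm.map f⟩

theorem IsUniserial.subsingleton_iff (h : D.IsUniserial M a l) : Subsingleton M ↔ l = 0 := by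
  obtain ⟨m, hm⟩ := h
  have h0 := hm.pow_smul_eq_zero_iff 0
  rw [pow_zero, one_smul, nonpos_iff_eq_zero] at h0
  constructor
  · intro _
    exact h0.mp (Subsingleton.elim _ _)
  · intro hl
    refine subsingleton_of_forall_eq 0 fun v => ?_
    obtain ⟨p, rfl⟩ := hm.exists_eq v
    rw [h0.mpr hl, smul_zero]

theorem IsGenerator.toSpanSingleton_surjective {m : M} (h : D.IsGenerator m a l) :
    Function.Surjective (LinearMap.toSpanSingleton Λ M m) := fun v => by
  obtain ⟨p, rfl⟩ := h.exists_eq v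
  exact ⟨aeval D.x p, rfl⟩

theorem IsGenerator.smul_eq_zero_iff {m : M} (h : D.IsGenerator m a l) {r : Λ} {p : k[X]}
    (hp : r * D.e a = aeval D.x p * D.e a) : r • m = 0 ↔ X ^ l ∣ p := by
  rw [← D.aeval_smul_eq_zero_iff h.pow_smul_eq_zero_iff]
  conv_lhs => rw [← h.e_smul, ← mul_smul, hp, mul_smul, h.e_smul]

/-- The annihilator of a generator depends only on its vertex and length, so both modules are the
same quotient of `Λ`. -/
theorem IsUniserial.nonempty_equiv (hM : D.IsUniserial M a l) (hN : D.IsUniserial N a l) :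
    Nonempty (M ≃ₗ[Λ] N) := by
  obtain ⟨m, hm⟩ := hM
  obtain ⟨m', hm'⟩ := hN
  have hk : LinearMap.ker (LinearMap.toSpanSingleton Λ M m) =
      LinearMap.ker (LinearMap.toSpanSingleton Λ N m') := by
    ext r
    obtain ⟨p, hp⟩ := D.exists_mul_e r a
    rw [LinearMap.mem_ker, LinearMap.mem_ker, LinearMap.toSpanSingleton_apply,
      LinearMap.toSpanSingleton_apply, hm.smul_eq_zero_iff hp, hm'.smul_eq_zero_iff hp]
  exact ⟨(LinearMap.quotKerEquivOfSurjective _ hm.toSpanSingleton_surjective).symm.trans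
    ((Submodule.quotEquivOfEq _ _ hk).trans
      (LinearMap.quotKerEquivOfSurjective _ hm'.toSpanSingleton_surjective))⟩

theorem IsGenerator.forall_pow_smul_iff {m : M} (h : D.IsGenerator m a l) (s : ℕ) :
    (∀ v : M, D.x ^ s • v = 0) ↔ l ≤ s := by
  rw [← h.pow_smul_eq_zero_iff]
  refine ⟨fun hv => hv m, fun hs v => ?_⟩
  obtain ⟨p, rfl⟩ := h.exists_eq v
  rw [← aeval_X_pow (R := k) D.x, ← mul_smul, ← map_mul, mul_comm, map_mul, mul_smul, aeval_X_pow,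
    hs, smul_zero]

theorem IsUniserial.length_unique (h : D.IsUniserial M a l) (h' : D.IsUniserial M a' l') :
    l = l' := by
  obtain ⟨m, hm⟩ := h
  obtain ⟨m', hm'⟩ := h'
  refine eq_of_forall_ge_iff fun s => ?_
  rw [← hm.forall_pow_smul_iff, ← hm'.forall_pow_smul_iff]

/-- If the vertices differed, `e a` would kill the constant term in the expression of `m` through
`m'`, so `m` would lie in `x M`. Then `m = x q(x) m`, contradicting that `1 - X q` is not divisible
by `X`. -/
theorem IsUniserial.top_unique (h : D.IsUniserial M a l) (h' : D.IsUniserial M a' l')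
    (hl : 0 < l) : a = a' := by
  obtain ⟨m, hm⟩ := h
  obtain ⟨m', hm'⟩ := h'
  by_contra hne
  obtain ⟨p, hp⟩ := hm'.exists_eq m
  obtain ⟨b, hb⟩ : ∃ b, b + 1 = a := ⟨a - 1, sub_add_cancel a 1⟩
  have h₁ : m = D.x • (D.e b * aeval D.x p.divX) • m' := by
    have h0 : D.e a • algebraMap k Λ (p.coeff 0) • m' = 0 := by
      rw [← mul_smul, ← Algebra.commutes, mul_smul, ← hm'.e_smul, ← mul_smul (D.e a),
        D.e_mul_e _ _ hne, zero_smul, smul_zero]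
    rw [← mul_smul, ← mul_assoc, D.x_mul_e, hb, mul_assoc]
    conv_lhs => rw [← hm.e_smul, hp, ← divX_mul_X_add p, mul_comm, map_add, map_mul, aeval_X,
      aeval_C, add_smul, smul_add, h0, add_zero, ← mul_smul]
  obtain ⟨q, hq⟩ := hm.exists_eq ((D.e b * aeval D.x p.divX) • m')
  have h₂ : aeval D.x (1 - X * q) • m = 0 := by
    rw [map_sub, map_one, map_mul, aeval_X, sub_smul, one_smul, mul_smul, ← hq, ← h₁, sub_self]
  rw [D.aeval_smul_eq_zero_iff hm.pow_smul_eq_zero_iff, X_pow_dvd_iff] at h₂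
  simpa using h₂ 0 hl

/-- A map out of a uniserial module which does not kill the socle is injective. -/
theorem IsGenerator.injective_of_socle {m : M} (h : D.IsGenerator m a l) (f : M →ₗ[Λ] N)
    (hf : f (D.x ^ (l - 1) • m) ≠ 0) : Function.Injective f := by
  rw [injective_iff_map_eq_zero]
  intro v hv
  by_contra hv0
  obtain ⟨p, rfl⟩ := h.exists_eq v
  obtain ⟨j, c, hc, hj⟩ := D.exists_pow_smul_eq ((h.pow_smul_eq_zero_iff l).mpr le_rfl) hv0
  have h' := congrArg f hj
  rw [map_smul, hv, smul_zero, map_smul] at h'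
  exact hf (algebraMap_smul_eq_zero hc h'.symm)

theorem IsGenerator.socle_ne_zero {m : M} (h : D.IsGenerator m a l) (hl : 0 < l) :
    D.x ^ (l - 1) • m ≠ 0 := fun h0 => by
  have := (h.pow_smul_eq_zero_iff _).mp h0
  omega

theorem IsUniserial.finite (h : D.IsUniserial M a l) : Module.Finite Λ M := by
  obtain ⟨m, hm⟩ := h
  exact Module.Finite.of_surjective _ hm.toSpanSingleton_surjective

/-- The identity of `M` is the sum of its two components through `X` and `Y`, and one of these does
not kill the socle generator. That one is injective, hence bijective as `M` is Artinian. This plays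
the role of a local endomorphism ring. -/
theorem IsUniserial.isDirectSummand_or [IsArtinianRing Λ] {X Y : Type u} [AddCommGroup X]
    [Module Λ X] [AddCommGroup Y] [Module Λ Y] (h : D.IsUniserial M a l)
    (hXY : IsDirectSummand (A := Λ) M (X × Y)) (hl : 0 < l) :
    IsDirectSummand (A := Λ) M X ∨ IsDirectSummand (A := Λ) M Y := by
  have := h.finite
  obtain ⟨m, hm⟩ := h
  obtain ⟨i, p, hip⟩ := hXY
  have key : ∀ {Z : Type u} [AddCommGroup Z] [Module Λ Z] (i : M →ₗ[Λ] Z) (p : Z →ₗ[Λ] M),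
      (p ∘ₗ i) (D.x ^ (l - 1) • m) ≠ 0 → IsDirectSummand (A := Λ) M Z := by
    intro Z _ _ i p h0
    have hb := IsArtinian.bijective_of_injective_endomorphism _ (hm.injective_of_socle _ h0)
    let e := LinearEquiv.ofBijective _ hb
    exact ⟨i, e.symm.toLinearMap ∘ₗ p, LinearMap.ext fun v => e.symm_apply_apply v⟩
  have hs : (p ∘ₗ LinearMap.inl Λ X Y ∘ₗ LinearMap.fst Λ X Y ∘ₗ i) (D.x ^ (l - 1) • m) +
      (p ∘ₗ LinearMap.inr Λ X Y ∘ₗ LinearMap.snd Λ X Y ∘ₗ i) (D.x ^ (l - 1) • m) =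
        D.x ^ (l - 1) • m := by
    conv_rhs => rw [← LinearMap.id_apply (R := Λ) (D.x ^ (l - 1) • m), ← hip]
    simp only [LinearMap.comp_apply, ← map_add]
    rw [LinearMap.inl_apply, LinearMap.inr_apply, Prod.mk_add_mk, add_zero, zero_add]
    rfl
  by_cases h₁ : (p ∘ₗ LinearMap.inl Λ X Y ∘ₗ LinearMap.fst Λ X Y ∘ₗ i) (D.x ^ (l - 1) • m) = 0
  · rw [h₁, zero_add] at hs
    exact Or.inr (key (LinearMap.snd Λ X Y ∘ₗ i) (p ∘ₗ LinearMap.inr Λ X Y)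
      (hs.trans_ne (hm.socle_ne_zero hl)))
  · exact Or.inl (key (LinearMap.fst Λ X Y ∘ₗ i) (p ∘ₗ LinearMap.inl Λ X Y) h₁)

/-- The retraction `p` is an isomorphism: if it killed the socle generator of `N`, then pushing `i
m` into the socle of `N` would make that generator zero, which forces `N = 0`. -/
theorem IsUniserial.eq_of_isDirectSummand (hM : D.IsUniserial M a l) (hN : D.IsUniserial N a' l')
    (h : IsDirectSummand (A := Λ) M N) (hl : 0 < l) : a = a' ∧ l = l' := by
  obtain ⟨m', hm'⟩ := hN
  have hm := hM
  obtain ⟨m, hm⟩ := hm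
  obtain ⟨i, p, hip⟩ := h
  have hp : ∀ v, p (i v) = v := fun v => LinearMap.congr_fun hip v
  have hinj : Function.Injective p := by
    refine hm'.injective_of_socle p fun h0 => ?_
    obtain ⟨q, hq⟩ := hm'.exists_eq (i m)
    have hq0 : aeval D.x q • m' ≠ 0 := fun h => by
      have h1 := hp m
      rw [hq, h, map_zero] at h1
      exact hm.socle_ne_zero hl (by rw [← h1, smul_zero])
    obtain ⟨j, c, hc, hj⟩ := D.exists_pow_smul_eq ((hm'.pow_smul_eq_zero_iff l').mpr le_rfl) hq0
    rw [← hq] at hj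
    have h1 := congrArg p hj
    rw [map_smul, hp, map_smul, h0, smul_zero] at h1
    have h2 : D.x ^ j • i m = 0 := by rw [← map_smul, h1, map_zero]
    rw [hj] at h2
    have h3 := algebraMap_smul_eq_zero hc h2
    have hz : l' = 0 := by
      have := (hm'.pow_smul_eq_zero_iff _).mp h3
      omega
    have := (IsUniserial.subsingleton_iff ⟨m', hm'⟩).mpr hz
    exact hq0 (Subsingleton.elim _ _)
  have e : N ≃ₗ[Λ] M := LinearEquiv.ofBijective p ⟨hinj, fun v => ⟨i v, hp v⟩⟩
  have hN' : D.IsUniserial M a' l' := ⟨_, hm'.map e⟩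
  exact ⟨hM.top_unique hN' hl, hM.length_unique hN'⟩

end Uniserial

end CyclicGenerators

end

noncomputable section

namespace CyclicGenerators

open Polynomial Homological

variable {k Λ : Type u} [Field k] [Ring Λ] [Algebra k Λ] {n : ℕ} [NeZero n]
  (D : CyclicGenerators k Λ n)

/-! ### Indecomposable projective modules -/

theorem exists_pow_mul_e_eq_zero (a : ZMod n) : ∃ s, D.x ^ s * D.e a = 0 := by
  obtain ⟨s, hs⟩ := D.isNilpotent_x
  exact ⟨s, by rw [hs, zero_mul]⟩

open Classical in
/-- The length of the projective module `Λ e_a`. -/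
def kupisch (a : ZMod n) : ℕ := Nat.find (D.exists_pow_mul_e_eq_zero a)

theorem pow_mul_e_eq_zero_iff (a : ZMod n) (s : ℕ) :
    D.x ^ s * D.e a = 0 ↔ D.kupisch a ≤ s := by
  classical
  refine ⟨fun h => Nat.find_min' _ h, fun h => ?_⟩
  rw [← Nat.sub_add_cancel h, pow_add, mul_assoc]
  have := Nat.find_spec (D.exists_pow_mul_e_eq_zero a)
  rw [kupisch, this, mul_zero]

theorem two_le_kupisch (a : ZMod n) : 2 ≤ D.kupisch a := by
  by_contra h
  have h1 := (D.pow_mul_e_eq_zero_iff a 1).mpr (by omega)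
  rw [pow_one] at h1
  exact D.x_mul_e_ne_zero a h1

/-- Multiplication by `x` maps `Λ e_(a+1)` onto the radical of `Λ e_a`. This inequality is what
makes `succ` monotone. -/
theorem kupisch_le (a : ZMod n) : D.kupisch a ≤ D.kupisch (a + 1) + 1 := by
  rw [← D.pow_mul_e_eq_zero_iff, pow_succ, mul_assoc, D.x_mul_e, ← mul_assoc,
    (D.pow_mul_e_eq_zero_iff _ _).mpr le_rfl, zero_mul]

/-- The projective module `Λ e_a`. -/
abbrev proj (a : ZMod n) : Submodule Λ Λ := Submodule.span Λ {D.e a}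

theorem e_mem_proj (a : ZMod n) : D.e a ∈ D.proj a := Submodule.mem_span_singleton_self _

section Span

variable {M : Type u} [AddCommGroup M] [Module Λ M]

theorem isGenerator_span {m : M} {a : ZMod n} {l : ℕ} (ha : D.e a • m = m)
    (hl : ∀ s, D.x ^ s • m = 0 ↔ l ≤ s) :
    D.IsGenerator (⟨m, Submodule.mem_span_singleton_self m⟩ : Submodule.span Λ {m}) a l where
  e_smul := Subtype.ext ha
  exists_eq := by
    rintro ⟨v, hv⟩
    obtain ⟨r, rfl⟩ := Submodule.mem_span_singleton.mp hv
    obtain ⟨p, hp⟩ := D.exists_smul_eq ha r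
    exact ⟨p, Subtype.ext hp⟩
  pow_smul_eq_zero_iff := fun s => by
    rw [← hl s, ← Submodule.coe_eq_zero]
    rfl

end Span

theorem isGenerator_e (a : ZMod n) :
    D.IsGenerator (⟨D.e a, D.e_mem_proj a⟩ : D.proj a) a (D.kupisch a) :=
  D.isGenerator_span (D.e_mul_self a) (D.pow_mul_e_eq_zero_iff a)

theorem isUniserial_proj (a : ZMod n) : D.IsUniserial (D.proj a) a (D.kupisch a) :=
  ⟨_, D.isGenerator_e a⟩

theorem isDirectSummand_proj (a : ZMod n) : IsDirectSummand (A := Λ) (D.proj a) Λ := by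
  refine ⟨(D.proj a).subtype, (LinearMap.toSpanSingleton Λ Λ (D.e a)).codRestrict _ fun r =>
    Submodule.mem_span_singleton.mpr ⟨r, rfl⟩, ?_⟩
  ext ⟨v, hv⟩
  obtain ⟨r, rfl⟩ := Submodule.mem_span_singleton.mp hv
  simp [mul_assoc, D.e_mul_self]

theorem projective_proj (a : ZMod n) : Module.Projective Λ (D.proj a) := by
  obtain ⟨i, p, h⟩ := D.isDirectSummand_proj a
  exact Module.Projective.of_split i p h

variable {D}

/-! ### Projective covers of uniserial modules and their kernels. -/

section Cover

variable {M : Type u} [AddCommGroup M] [Module Λ M] {a : ZMod n} {l : ℕ}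

theorem IsUniserial.le_kupisch (h : D.IsUniserial M a l) : l ≤ D.kupisch a := by
  obtain ⟨m, hm⟩ := h
  rw [← hm.pow_smul_eq_zero_iff, ← hm.e_smul, ← mul_smul,
    (D.pow_mul_e_eq_zero_iff _ _).mpr le_rfl, zero_smul]

variable (D) in
/-- The map `Λ e_a → M` sending `e_a` to `m`. -/
def projMap (a : ZMod n) (m : M) : D.proj a →ₗ[Λ] M :=
  LinearMap.toSpanSingleton Λ M m ∘ₗ (D.proj a).subtype

theorem projMap_apply (m : M) (v : D.proj a) : D.projMap a m v = (v : Λ) • m := rfl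

theorem IsGenerator.projMap_surjective {m : M} (h : D.IsGenerator m a l) :
    Function.Surjective (D.projMap a m) := fun v => by
  obtain ⟨p, rfl⟩ := h.exists_eq v
  refine ⟨⟨aeval D.x p * D.e a, Submodule.smul_mem _ _ (D.e_mem_proj a)⟩, ?_⟩
  rw [projMap_apply, mul_smul, h.e_smul]

theorem IsGenerator.exists_eq_of_mem_ker {m : M} (h : D.IsGenerator m a l) {v : D.proj a}
    (hv : v ∈ LinearMap.ker (D.projMap a m)) :
    ∃ q : k[X], (v : Λ) = aeval D.x (q * X ^ l) * D.e a := by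
  obtain ⟨p, rfl⟩ := (D.isGenerator_e a).exists_eq v
  rw [LinearMap.mem_ker, projMap_apply] at hv
  have hv' : (aeval D.x p * D.e a) • m = 0 := hv
  rw [mul_smul, h.e_smul, D.aeval_smul_eq_zero_iff h.pow_smul_eq_zero_iff] at hv'
  obtain ⟨q, rfl⟩ := hv'
  exact ⟨q, by rw [mul_comm q]; rfl⟩

theorem IsGenerator.isUniserial_ker {m : M} (h : D.IsGenerator m a l) :
    D.IsUniserial (LinearMap.ker (D.projMap a m)) (a + l) (D.kupisch a - l) := by
  have hmem : D.x ^ l * D.e a ∈ D.proj a := Submodule.smul_mem _ _ (D.e_mem_proj a)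
  refine ⟨⟨⟨D.x ^ l * D.e a, hmem⟩, ?_⟩, ⟨?_, ?_, fun s => ?_⟩⟩
  · rw [LinearMap.mem_ker, projMap_apply, mul_smul, h.e_smul]
    exact (h.pow_smul_eq_zero_iff l).mpr le_rfl
  · refine Subtype.ext (Subtype.ext ?_)
    change D.e (a + l) * (D.x ^ l * D.e a) = D.x ^ l * D.e a
    rw [D.x_pow_mul_e, ← mul_assoc, D.e_mul_self]
  · rintro ⟨v, hv⟩
    obtain ⟨q, hq⟩ := h.exists_eq_of_mem_ker hv
    refine ⟨q, Subtype.ext (Subtype.ext ?_)⟩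
    rw [hq, map_mul, aeval_X_pow, mul_assoc]
    rfl
  · rw [← Submodule.coe_eq_zero, ← Submodule.coe_eq_zero]
    change D.x ^ s * (D.x ^ l * D.e a) = 0 ↔ _
    rw [← mul_assoc, ← pow_add, D.pow_mul_e_eq_zero_iff]
    omega

/-- Split `e a = y + z` with `y` in `N` and `z` in the kernel. As `l > 0`, `z` is a nilpotent
multiple of `e a`, so `y` is a unit multiple of `e a` and `N` contains the generator. -/
theorem IsGenerator.superfluous_ker {m : M} (h : D.IsGenerator m a l) (hl : 0 < l)
    (N : Submodule Λ (D.proj a)) (hN : N ⊔ LinearMap.ker (D.projMap a m) = ⊤) : N = ⊤ := by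
  have hg := D.isGenerator_e a
  obtain ⟨y, hy, z, hz, hyz⟩ := Submodule.mem_sup.mp
    (hN ▸ Submodule.mem_top : (⟨D.e a, D.e_mem_proj a⟩ : D.proj a) ∈ _)
  obtain ⟨q, hq⟩ := h.exists_eq_of_mem_ker hz
  have hnil : IsNilpotent (aeval D.x (q * X ^ l)) := by
    obtain ⟨s, hs⟩ := D.isNilpotent_x
    refine ⟨s, ?_⟩
    rw [← map_pow, mul_pow, ← pow_mul, mul_comm l, pow_mul, map_mul, map_pow (aeval D.x) (X ^ s),
      aeval_X_pow, hs, zero_pow hl.ne', mul_zero]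
  obtain ⟨u, hu⟩ := hnil.isUnit_one_sub
  have hy' : y = (u : Λ) • (⟨D.e a, D.e_mem_proj a⟩ : D.proj a) := by
    refine Subtype.ext ?_
    have h1 := congrArg Subtype.val (eq_sub_of_add_eq hyz)
    rw [h1, hu]
    change D.e a - (z : Λ) = (1 - _) * D.e a
    rw [hq, sub_mul, one_mul]
  have he : (⟨D.e a, D.e_mem_proj a⟩ : D.proj a) ∈ N := by
    have h1 := N.smul_mem (↑u⁻¹ : Λ) hy
    rwa [hy', ← mul_smul, Units.inv_mul, one_smul] at h1
  refine eq_top_iff.mpr fun v _ => ?_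
  obtain ⟨p, rfl⟩ := hg.exists_eq v
  exact N.smul_mem _ he

theorem exists_isUniserial (D : CyclicGenerators k Λ n) (a : ZMod n) {l : ℕ}
    (hl : l ≤ D.kupisch a) : ∃ M : FGModuleCat.{u} Λ, D.IsUniserial M a l := by
  let K : Submodule Λ (D.proj a) :=
    Submodule.span Λ {(D.x ^ l) • (⟨D.e a, D.e_mem_proj a⟩ : D.proj a)}
  have hg := D.isGenerator_e a
  refine ⟨FGModuleCat.of Λ (D.proj a ⧸ K), K.mkQ ⟨D.e a, D.e_mem_proj a⟩, ?_, ?_, fun s => ?_⟩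
  · rw [← map_smul, hg.e_smul]
  · intro v
    obtain ⟨w, rfl⟩ := K.mkQ_surjective v
    obtain ⟨p, rfl⟩ := hg.exists_eq w
    exact ⟨p, map_smul _ _ _⟩
  · rw [← map_smul, Submodule.mkQ_apply, Submodule.Quotient.mk_eq_zero]
    constructor
    · intro hs
      obtain ⟨r, hr⟩ := Submodule.mem_span_singleton.mp hs
      -- The vector `x ^ l • e a` is concentrated at the vertex `a + l`, so the coefficient `r` may
      -- be replaced by a polynomial in `x`; divisibility in `k[X]` then decides membership in `K`.
      have he : D.e (a + l) • D.x ^ l • (⟨D.e a, D.e_mem_proj a⟩ : D.proj a) =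
          D.x ^ l • (⟨D.e a, D.e_mem_proj a⟩ : D.proj a) := by
        rw [← mul_smul, ← D.x_pow_mul_e, mul_smul, hg.e_smul]
      obtain ⟨p, hp⟩ := D.exists_smul_eq he r
      have h0 : aeval D.x (X ^ s - p * X ^ l) • (⟨D.e a, D.e_mem_proj a⟩ : D.proj a) = 0 := by
        rw [map_sub, map_mul, aeval_X_pow, aeval_X_pow, sub_smul, mul_smul, ← hp, hr, sub_self]
      rw [D.aeval_smul_eq_zero_iff hg.pow_smul_eq_zero_iff] at h0
      have h1 : (X : k[X]) ^ l ∣ X ^ s :=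
        (dvd_sub_left (dvd_mul_left _ p)).mp ((pow_dvd_pow X hl).trans h0)
      exact (pow_dvd_pow_iff X_ne_zero not_isUnit_X).mp h1
    · intro hs
      rw [← Nat.sub_add_cancel hs, pow_add, mul_smul]
      exact K.smul_mem _ (Submodule.mem_span_singleton_self _)

end Cover

section Syzygy

variable [IsArtinianRing Λ] {M : FGModuleCat.{u} Λ} {a : ZMod n} {l : ℕ}

theorem IsUniserial.syzygy (h : D.IsUniserial M a l) (hl : 0 < l) :
    D.IsUniserial (Homological.syzygy M) (a + l) (D.kupisch a - l) := by
  obtain ⟨m, hm⟩ := h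
  have hc : IsProjectiveCover (P := FGModuleCat.of Λ (D.proj a)) (D.projMap a m) :=
    ⟨D.projective_proj a, hm.projMap_surjective, hm.superfluous_ker hl⟩
  obtain ⟨e⟩ := hc.nonempty_syzygy_equiv
  exact hm.isUniserial_ker.congr e.symm

theorem IsUniserial.projective_iff (h : D.IsUniserial M a l) (hl : 0 < l) :
    Module.Projective Λ M ↔ l = D.kupisch a := by
  constructor
  · intro hP
    have h0 := (h.syzygy hl).subsingleton_iff.mp (subsingleton_syzygy hP)
    have := h.le_kupisch
    omega
  · intro h0
    refine projective_of_subsingleton_syzygy ((h.syzygy hl).subsingleton_iff.mpr ?_)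
    omega

theorem IsUniserial.isDirectSummand_of_projective (h : D.IsUniserial M a l) (hl : 0 < l)
    (hP : Module.Projective Λ M) : IsDirectSummand (A := Λ) M Λ := by
  rw [h.projective_iff hl] at hP
  obtain ⟨e⟩ := h.nonempty_equiv (hP ▸ D.isUniserial_proj a)
  exact (IsDirectSummand.of_equiv e).trans (D.isDirectSummand_proj a)

end Syzygy

/-! ### Decomposition into uniserial modules -/

section Decomposition

/-- A cyclic submodule of maximal Loewy length is a direct summand. -/
theorem exists_isCompl_span {M : Type u} [AddCommGroup M] [Module Λ M] {m : M} {a : ZMod n}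
    {l : ℕ} (hl : 0 < l) (ha : D.e a • m = m) (hm : D.x ^ (l - 1) • m ≠ 0)
    (hM : ∀ v : M, D.x ^ l • v = 0) :
    ∃ N : Submodule Λ M, IsCompl (Submodule.span Λ {m}) N := by
  let _ : Module k M := Module.compHom M (algebraMap k Λ)
  have hk : ∀ (c : k) (v : M), algebraMap k Λ c • v = c • v := fun _ _ => rfl
  -- A linear functional that does not vanish on the socle generator of the cyclic submodule; `b` is
  -- the vertex of that socle.
  obtain ⟨φ, hφ⟩ : ∃ φ : M →ₗ[k] k, φ (D.x ^ (l - 1) • m) ≠ 0 := by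
    by_contra! h
    exact hm ((Module.forall_dual_apply_eq_zero_iff k _).mp h)
  set b : ZMod n := a + ((l - 1 : ℕ) : ZMod n)
  have hb : D.e b • D.x ^ (l - 1) • m = D.x ^ (l - 1) • m := by
    rw [← mul_smul, ← D.x_pow_mul_e, mul_smul, ha]
  -- The largest submodule on which `φ ∘ e b` vanishes. It meets the span trivially because every
  -- nonzero element of the span can be pushed into its socle.
  let N : Submodule Λ M :=
    { carrier := {v | ∀ r : Λ, φ (D.e b • r • v) = 0}
      add_mem' := fun {v w} hv hw r => by
        rw [smul_add, smul_add, map_add, hv, hw, add_zero]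
      zero_mem' := fun r => by rw [smul_zero, smul_zero, map_zero]
      smul_mem' := fun r v hv r' => by
        rw [← mul_smul r']
        exact hv _ }
  refine ⟨N, ?_, ?_⟩
  · rw [Submodule.disjoint_def]
    intro v hv hvN
    by_contra hv0
    obtain ⟨r, rfl⟩ := Submodule.mem_span_singleton.mp hv
    obtain ⟨p, hp⟩ := D.exists_smul_eq ha r
    rw [hp] at hv0 hvN
    obtain ⟨j, c, hc, hj⟩ := D.exists_pow_smul_eq (hM m) hv0
    have h0 := hvN (D.x ^ j)
    rw [hj, ← mul_smul, ← Algebra.commutes, mul_smul, hb, hk, map_smul, smul_eq_mul] at h0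
    exact (mul_ne_zero hc hφ) h0
  · rw [codisjoint_iff, eq_top_iff]
    intro v _
    -- Successive approximation of the component of `v` in the span: adding a multiple of `x ^ r •
    -- m` corrects the pairing at `j = l - r - 1` and leaves larger `j` untouched, since `x ^ (j +
    -- r)` then kills `m`.
    have key : ∀ r ≤ l, ∃ u ∈ Submodule.span Λ {m},
        ∀ j, l ≤ j + r → φ (D.e b • D.x ^ j • (v - u)) = 0 := by
      intro r
      induction r with
      | zero =>
        refine fun _ => ⟨0, Submodule.zero_mem _, fun j hj => ?_⟩
        rw [← Nat.sub_add_cancel (show l ≤ j from hj), pow_add, mul_smul, hM, smul_zero, smul_zero,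
          map_zero]
      | succ r ih =>
        intro hr
        obtain ⟨u, hu, huj⟩ := ih (by omega)
        set c := φ (D.e b • D.x ^ (l - r - 1) • (v - u)) / φ (D.x ^ (l - 1) • m) with hc
        refine ⟨u + algebraMap k Λ c • D.x ^ r • m, Submodule.add_mem _ hu
          (Submodule.smul_mem _ _ (Submodule.smul_mem _ _ (Submodule.mem_span_singleton_self m))),
          fun j hj => ?_⟩
        have hcomm : D.e b • D.x ^ j • algebraMap k Λ c • D.x ^ r • m =
            c • D.e b • D.x ^ (j + r) • m := by
          rw [← hk, pow_add, ← mul_smul (D.x ^ j), ← Algebra.commutes, mul_smul,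
            ← mul_smul (D.e b), ← Algebra.commutes, mul_smul, mul_smul (D.x ^ j)]
        rw [← sub_sub, smul_sub, smul_sub, map_sub, hcomm]
        rcases Nat.lt_or_ge (j + r) l with hlt | hge
        · have hj' : j = l - r - 1 := by omega
          rw [show j + r = l - 1 by omega, hb, map_smul φ c, smul_eq_mul, hc,
            div_mul_cancel₀ _ hφ, hj', sub_self]
        · rw [huj j hge, ← Nat.sub_add_cancel hge, pow_add, mul_smul, hM, smul_zero, smul_zero,
            smul_zero, map_zero, sub_zero]
    obtain ⟨u, hu, huj⟩ := key l le_rfl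
    refine Submodule.mem_sup.mpr ⟨u, hu, v - u, fun r => ?_, add_sub_cancel u v⟩
    -- After multiplication by `e b`, an arbitrary `r` acts as a polynomial in `x`, so the pairings
    -- with powers of `x` suffice.
    obtain ⟨q, hq⟩ := D.exists_e_mul r b
    rw [← mul_smul, hq, mul_smul]
    induction q using Polynomial.induction_on' generalizing r with
    | add p₁ p₂ h₁ h₂ =>
      rw [map_add, add_smul, smul_add, map_add, h₁ (aeval D.x p₁) rfl, h₂ (aeval D.x p₂) rfl,
        add_zero]
    | monomial s c =>
      rw [aeval_monomial, mul_smul, ← mul_smul (D.e b), ← Algebra.commutes, mul_smul, hk, map_smul,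
        huj s (Nat.le_add_left l s), smul_zero]

variable (D) in
/-- Every finitely generated module is a finite direct sum of uniserial modules. -/
theorem induction_on_modules [IsArtinianRing Λ] {P : FGModuleCat.{u} Λ → Prop}
    (zero : ∀ M : FGModuleCat.{u} Λ, Subsingleton M → P M)
    (prod : ∀ X Y Z : FGModuleCat.{u} Λ, (Z ≃ₗ[Λ] X × Y) → P X → P Y → P Z)
    (uniserial : ∀ (M : FGModuleCat.{u} Λ) (a : ZMod n) (l : ℕ), 0 < l → D.IsUniserial M a l → P M)
    (M : FGModuleCat.{u} Λ) : P M := by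
  classical
  generalize hL : Module.length Λ M = L
  induction L using WellFoundedLT.induction generalizing M with
  | _ L ih =>
    rcases subsingleton_or_nontrivial M with hs | hs
    · exact zero M hs
    have hex : ∃ l, ∀ v : M, D.x ^ l • v = 0 := by
      obtain ⟨s, hs⟩ := D.isNilpotent_x
      exact ⟨s, fun v => by rw [hs, zero_smul]⟩
    obtain ⟨l, hl, hmin⟩ : ∃ l, (∀ v : M, D.x ^ l • v = 0) ∧
        ∀ j < l, ∃ v : M, D.x ^ j • v ≠ 0 :=
      ⟨Nat.find hex, Nat.find_spec hex, fun j hj => not_forall.mp (Nat.find_min hex hj)⟩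
    have hl0 : 0 < l := by
      by_contra h
      obtain ⟨v, hv⟩ := exists_ne (0 : M)
      have := hl v
      rw [show l = 0 by omega, pow_zero, one_smul] at this
      exact hv this
    obtain ⟨v, hv⟩ := hmin (l - 1) (by omega)
    obtain ⟨a, ha⟩ : ∃ a, D.x ^ (l - 1) • D.e a • v ≠ 0 := by
      by_contra! h
      apply hv
      rw [← one_smul Λ v, ← D.sum_e, Finset.sum_smul, Finset.smul_sum]
      exact Finset.sum_eq_zero fun i _ => h i
    have hea : D.e a • D.e a • v = D.e a • v := by rw [← mul_smul, D.e_mul_self]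
    have hgen := D.isGenerator_span (l := l) hea fun s => by
      constructor
      · intro h0
        by_contra hs
        apply ha
        rw [show l - 1 = (l - 1 - s) + s by omega, pow_add, mul_smul, h0, smul_zero]
      · intro h0
        rw [← Nat.sub_add_cancel h0, pow_add, mul_smul, hl, smul_zero]
    obtain ⟨N, hN⟩ := exists_isCompl_span hl0 hea ha hl
    refine prod (FGModuleCat.of Λ (Submodule.span Λ {D.e a • v})) (FGModuleCat.of Λ N) M
      (Submodule.prodEquivOfIsCompl _ _ hN).symm
      (uniserial (FGModuleCat.of Λ (Submodule.span Λ {D.e a • v})) a l hl0 ⟨_, hgen⟩)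
      (ih (Module.length Λ N) ?_ (FGModuleCat.of Λ N) rfl)
    rw [← hL]
    refine Submodule.length_lt fun htop => ha ?_
    have hmem : D.e a • v ∈ Submodule.span Λ {D.e a • v} ⊓ N :=
      ⟨Submodule.mem_span_singleton_self _, htop ▸ Submodule.mem_top⟩
    rw [hN.inf_eq_bot, Submodule.mem_bot] at hmem
    rw [hmem, smul_zero]

end Decomposition

/-! ### Simple modules -/

theorem IsUniserial.isSimpleModule {M : Type u} [AddCommGroup M] [Module Λ M] {a : ZMod n}
    (h : D.IsUniserial M a 1) : IsSimpleModule Λ M := by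
  have hnt : Nontrivial M := by
    rw [← not_subsingleton_iff_nontrivial, h.subsingleton_iff]
    exact one_ne_zero
  obtain ⟨m, hm⟩ := h
  rw [isSimpleModule_iff_toSpanSingleton_surjective]
  refine ⟨hnt, fun v hv w => ?_⟩
  obtain ⟨p, rfl⟩ := hm.exists_eq v
  obtain ⟨r, rfl⟩ := hm.toSpanSingleton_surjective w
  obtain ⟨j, c, hc, hj⟩ := D.exists_pow_smul_eq ((hm.pow_smul_eq_zero_iff 1).mpr le_rfl) hv
  refine ⟨r * algebraMap k Λ c⁻¹ * D.x ^ j, ?_⟩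
  rw [LinearMap.toSpanSingleton_apply, mul_smul, hj, Nat.sub_self, pow_zero, one_smul, ← mul_smul,
    mul_assoc, ← map_mul, inv_mul_cancel₀ hc, map_one, mul_one]
  rfl

variable (D) in
theorem exists_isUniserial_of_isSimpleModule (M : Type u) [AddCommGroup M] [Module Λ M]
    [IsSimpleModule Λ M] : ∃ a, D.IsUniserial M a 1 := by
  have := IsSimpleModule.nontrivial Λ M
  obtain ⟨v, hv⟩ := exists_ne (0 : M)
  obtain ⟨a, ha⟩ : ∃ a, D.e a • v ≠ 0 := by
    by_contra! h
    apply hv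
    rw [← one_smul Λ v, ← D.sum_e, Finset.sum_smul]
    exact Finset.sum_eq_zero fun i _ => h i
  have hea : D.e a • D.e a • v = D.e a • v := by rw [← mul_smul, D.e_mul_self]
  set m := D.e a • v
  -- Otherwise `x • m` generates the simple module, so `m = p(x) x m` for some `p`. Iterating
  -- contradicts the nilpotency of `x`.
  have hx : D.x • m = 0 := by
    by_contra hx
    obtain ⟨r, hr⟩ := IsSimpleModule.toSpanSingleton_surjective Λ hx m
    have he : D.e (a + 1) • D.x • m = D.x • m := by
      rw [← mul_smul, ← D.x_mul_e, mul_smul, hea]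
    obtain ⟨p, hp⟩ := D.exists_smul_eq he r
    rw [LinearMap.toSpanSingleton_apply, hp] at hr
    have hpow : ∀ s, aeval D.x (p ^ s * X ^ s) • m = m := by
      intro s
      induction s with
      | zero => simp
      | succ s ih =>
        rw [pow_succ, pow_succ, mul_mul_mul_comm, map_mul, mul_smul, map_mul _ p,
          aeval_X, mul_smul, hr, ih]
    obtain ⟨s, hs⟩ := D.isNilpotent_x
    have h0 := hpow s
    rw [map_mul, aeval_X_pow, hs, mul_zero, zero_smul] at h0
    exact ha h0.symm
  refine ⟨a, m, hea, fun w => ?_, fun s => ?_⟩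
  · obtain ⟨r, rfl⟩ := IsSimpleModule.toSpanSingleton_surjective Λ ha w
    exact D.exists_smul_eq hea r
  · rcases s with _ | s
    · simpa using ha
    · rw [pow_succ, mul_smul, hx, smul_zero]
      simp

end CyclicGenerators

end

noncomputable section

/-! ### Monotone maps of the integers commuting with a translation -/

theorem ZMod.intCast_eq_intCast_iff_exists_add {n : ℕ} {a b : ℤ} :
    (a : ZMod n) = b ↔ ∃ t : ℤ, a = b + n * t := by
  rw [eq_comm, ZMod.intCast_eq_intCast_iff_dvd_sub]
  exact exists_congr fun t => by rw [sub_eq_iff_eq_add']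

theorem ZMod.exists_intCast_eq {n : ℕ} (i : ZMod n) : ∃ a : ℤ, (a : ZMod n) = i :=
  ZMod.intCast_surjective i

section Periodic

variable {n : ℕ} [NeZero n] {f : ℤ → ℤ}

/-- Fibres are bounded below, because `f (x - n) = f x - n < f x`. -/
theorem Monotone.exists_first_preimage (hf : Monotone f)
    (hper : ∀ x t : ℤ, f (x + n * t) = f x + n * t) (x : ℤ) : ∃ y, f y = f x ∧ f (y - 1) ≠ f y := by
  obtain ⟨y, hy, hmin⟩ := Int.exists_least_of_bdd (P := fun y => f y = f x)
    ⟨x - n, fun z hz => by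
      by_contra! h
      have h1 := hf h.le
      have h2 := hper x (-1)
      rw [mul_neg_one, ← sub_eq_add_neg, ← sub_eq_add_neg] at h2
      have hn : (0 : ℤ) < n := by exact_mod_cast Nat.pos_of_ne_zero (NeZero.ne n)
      omega⟩ ⟨x, rfl⟩
  refine ⟨y, hy, fun h => ?_⟩
  have := hmin (y - 1) (h.trans hy)
  omega

open Classical in
/-- In a period, a monotone map has as many points of increase as values. -/
theorem Monotone.exists_finsets_card_eq (hf : Monotone f)
    (hper : ∀ x t : ℤ, f (x + n * t) = f x + n * t) :
    ∃ S T : Finset (ZMod n), S.card = T.card ∧ (∀ a : ℤ, (a : ZMod n) ∈ S ↔ f (a - 1) ≠ f a) ∧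
      ∀ a : ℤ, (a : ZMod n) ∈ T ↔ ∃ x, a = f x := by
  -- The map induced by `f` modulo `n`. It restricts to a bijection from points of increase to
  -- values, with inverse sending a value to the first point of its fibre.
  let g : ZMod n → ZMod n := fun i => (f i.val : ℤ)
  have hg : ∀ a : ℤ, g a = (f a : ℤ) := fun a => by
    obtain ⟨t, ht⟩ := ZMod.intCast_eq_intCast_iff_exists_add.mp
      (show (((a : ZMod n).val : ℤ) : ZMod n) = (a : ZMod n) by simp)
    simp only [g]
    rw [ht, hper]
    simp
  let S : Finset (ZMod n) := Finset.univ.filter fun i => f ((i.val : ℤ) - 1) ≠ f i.val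
  have hS : ∀ a : ℤ, (a : ZMod n) ∈ S ↔ f (a - 1) ≠ f a := fun a => by
    obtain ⟨t, ht⟩ := ZMod.intCast_eq_intCast_iff_exists_add.mp
      (show (((a : ZMod n).val : ℤ) : ZMod n) = (a : ZMod n) by simp)
    simp only [S, Finset.mem_filter, Finset.mem_univ, true_and]
    rw [ht, add_sub_right_comm, hper, hper, Ne, add_left_inj]
  have hT : ∀ a : ℤ, (a : ZMod n) ∈ S.image g ↔ ∃ x, a = f x := fun a => by
    rw [Finset.mem_image]
    constructor
    · rintro ⟨i, -, hi⟩
      obtain ⟨b, rfl⟩ := ZMod.exists_intCast_eq i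
      rw [hg, eq_comm] at hi
      obtain ⟨t, ht⟩ := ZMod.intCast_eq_intCast_iff_exists_add.mp hi
      exact ⟨b + n * t, by rw [ht, hper]⟩
    · rintro ⟨x, rfl⟩
      obtain ⟨y, hy, hy'⟩ := hf.exists_first_preimage hper x
      exact ⟨y, (hS y).mpr hy', by rw [hg, hy]⟩
  refine ⟨S, S.image g, (Finset.card_image_of_injOn ?_).symm, hS, hT⟩
  intro i hi j hj hij
  obtain ⟨a, rfl⟩ := ZMod.exists_intCast_eq i
  obtain ⟨b, rfl⟩ := ZMod.exists_intCast_eq j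
  rw [Finset.mem_coe, hS] at hi hj
  rw [hg, hg] at hij
  obtain ⟨t, ht⟩ := ZMod.intCast_eq_intCast_iff_exists_add.mp hij
  rw [← hper] at ht
  have hj' : f (b + n * t - 1) ≠ f (b + n * t) := by
    rwa [add_sub_right_comm, hper, hper, Ne, add_left_inj]
  refine ZMod.intCast_eq_intCast_iff_exists_add.mpr ⟨t, ?_⟩
  -- If two points of increase had the same value, monotonicity would make `f` constant between
  -- them, so the larger would not be a point of increase.
  rcases lt_trichotomy a (b + n * t) with h | h | h
  · exact absurd (le_antisymm (hf (by omega)) (ht.symm.le.trans (hf (by omega)))) hj'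
  · exact h
  · exact absurd (le_antisymm (hf (by omega)) (ht.le.trans (hf (by omega)))) hi

theorem Monotone.forall_mem_range_iff (hf : Monotone f)
    (hper : ∀ x t : ℤ, f (x + n * t) = f x + n * t) :
    (∀ a, ∃ x, a = f x) ↔ ∀ a, f a ≠ f (a + 1) := by
  obtain ⟨S, T, hc, hS, hT⟩ := hf.exists_finsets_card_eq hper
  have h₁ : (∀ a, ∃ x, a = f x) ↔ T.card = Fintype.card (ZMod n) := by
    rw [Finset.card_eq_iff_eq_univ, Finset.eq_univ_iff_forall]
    refine ⟨fun h i => ?_, fun h a => (hT a).mp (h a)⟩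
    obtain ⟨a, rfl⟩ := ZMod.exists_intCast_eq i
    exact (hT a).mpr (h a)
  have h₂ : (∀ a, f a ≠ f (a + 1)) ↔ S.card = Fintype.card (ZMod n) := by
    rw [Finset.card_eq_iff_eq_univ, Finset.eq_univ_iff_forall]
    refine ⟨fun h i => ?_, fun h a => ?_⟩
    · obtain ⟨a, rfl⟩ := ZMod.exists_intCast_eq i
      have := h (a - 1)
      rw [sub_add_cancel] at this
      exact (hS a).mpr this
    · have := (hS (a + 1)).mp (h _)
      rwa [add_sub_cancel_right] at this
  rw [h₁, h₂, hc]

/-- With `S` the points of increase and `T` the values modulo `n`, the two sides are `T ⊆ S` and `S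
⊆ T`; either inclusion is an equality because the cardinalities agree. -/
theorem Monotone.forall_increase_iff (hf : Monotone f)
    (hper : ∀ x t : ℤ, f (x + n * t) = f x + n * t) :
    (∀ x, f (f x - 1) ≠ f (f x)) ↔ ∀ a, (∃ x, a + 1 = f x) ∨ f a = f (a + 1) := by
  obtain ⟨S, T, hc, hS, hT⟩ := hf.exists_finsets_card_eq hper
  have h₁ : (∀ x, f (f x - 1) ≠ f (f x)) ↔ T ⊆ S := by
    refine ⟨fun h i hi => ?_, fun h x => (hS _).mp (h ((hT _).mpr ⟨x, rfl⟩))⟩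
    obtain ⟨a, rfl⟩ := ZMod.exists_intCast_eq i
    obtain ⟨x, rfl⟩ := (hT a).mp hi
    exact (hS _).mpr (h x)
  have h₂ : (∀ a, (∃ x, a + 1 = f x) ∨ f a = f (a + 1)) ↔ S ⊆ T := by
    refine ⟨fun h i hi => ?_, fun h a => ?_⟩
    · obtain ⟨a, rfl⟩ := ZMod.exists_intCast_eq i
      have h1 := h (a - 1)
      rw [sub_add_cancel] at h1
      exact (hT a).mpr (h1.resolve_right ((hS a).mp hi))
    · rw [or_iff_not_imp_right]
      intro h1
      refine (hT _).mp (h ((hS (a + 1)).mpr ?_))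
      rwa [add_sub_cancel_right]
  rw [h₁, h₂]
  constructor
  · intro h
    rw [Finset.eq_of_subset_of_card_le h hc.le]
  · intro h
    rw [Finset.eq_of_subset_of_card_le h hc.ge]

open Classical in
/-- A periodic map which is injective on its image is surjective on its image. -/
theorem exists_apply_apply_eq (hper : ∀ x t : ℤ, f (x + n * t) = f x + n * t)
    (hinj : ∀ a b, f (f a) = f (f b) → f a = f b) (y : ℤ) : ∃ x, f (f x) = f y := by
  let T : Finset (ZMod n) := Finset.univ.filter fun i => ∃ x, i = (f x : ℤ)
  have hT : ∀ a : ℤ, (a : ZMod n) ∈ T ↔ ∃ x, a = f x := fun a => by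
    simp only [T, Finset.mem_filter, Finset.mem_univ, true_and]
    constructor
    · rintro ⟨x, hx⟩
      obtain ⟨t, ht⟩ := ZMod.intCast_eq_intCast_iff_exists_add.mp hx
      exact ⟨x + n * t, by rw [ht, hper]⟩
    · rintro ⟨x, rfl⟩
      exact ⟨x, rfl⟩
  let g : ZMod n → ZMod n := fun i => (f i.val : ℤ)
  have hg : ∀ a : ℤ, g a = (f a : ℤ) := fun a => by
    obtain ⟨t, ht⟩ := ZMod.intCast_eq_intCast_iff_exists_add.mp
      (show (((a : ZMod n).val : ℤ) : ZMod n) = (a : ZMod n) by simp)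
    simp only [g]
    rw [ht, hper]
    simp
  -- `g` maps the finite set of values modulo `n` to itself, injectively by `hinj`, hence onto.
  have hsub : T.image g ⊆ T := by
    intro i hi
    obtain ⟨j, -, rfl⟩ := Finset.mem_image.mp hi
    obtain ⟨a, rfl⟩ := ZMod.exists_intCast_eq j
    rw [hg]
    exact (hT _).mpr ⟨a, rfl⟩
  have hcard : (T.image g).card = T.card := by
    refine Finset.card_image_of_injOn fun i hi j hj hij => ?_
    obtain ⟨a, rfl⟩ := ZMod.exists_intCast_eq i
    obtain ⟨b, rfl⟩ := ZMod.exists_intCast_eq j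
    obtain ⟨x, rfl⟩ := (hT a).mp hi
    obtain ⟨z, rfl⟩ := (hT b).mp hj
    rw [hg, hg] at hij
    obtain ⟨t, ht⟩ := ZMod.intCast_eq_intCast_iff_exists_add.mp hij
    rw [← hper, ← hper] at ht
    have := hinj _ _ ht
    rw [hper] at this
    exact ZMod.intCast_eq_intCast_iff_exists_add.mpr ⟨t, this⟩
  have hy : ((f y : ℤ) : ZMod n) ∈ T.image g := by
    rw [Finset.eq_of_subset_of_card_le hsub hcard.ge]
    exact (hT _).mpr ⟨y, rfl⟩
  obtain ⟨i, hi, hiy⟩ := Finset.mem_image.mp hy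
  obtain ⟨a, rfl⟩ := ZMod.exists_intCast_eq i
  obtain ⟨x, rfl⟩ := (hT a).mp hi
  rw [hg, eq_comm] at hiy
  obtain ⟨t, ht⟩ := ZMod.intCast_eq_intCast_iff_exists_add.mp hiy
  exact ⟨x + n * t, by rw [hper, hper, ht]⟩

end Periodic

namespace CyclicGenerators

open Homological

variable {k Λ : Type u} [Field k] [Ring Λ] [Algebra k Λ] {n : ℕ} [NeZero n]
  (D : CyclicGenerators k Λ n)

/-! ### Uniserial modules as intervals -/

/-- On the universal cover `ℤ` of the quiver, the vertex following the socle of the projective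
module with top `i`. -/
def succ (i : ℤ) : ℤ := i + D.kupisch i

theorem monotone_succ : Monotone D.succ := by
  refine monotone_int_of_le_succ fun i => ?_
  have := D.kupisch_le i
  rw [succ, succ, Int.cast_add, Int.cast_one]
  omega

theorem succ_add_mul (i t : ℤ) : D.succ (i + n * t) = D.succ i + n * t := by
  rw [succ, succ, Int.cast_add, Int.cast_mul, Int.cast_natCast, ZMod.natCast_self, zero_mul,
    add_zero, add_right_comm]

theorem add_two_le_succ (i : ℤ) : i + 2 ≤ D.succ i := by
  have := D.two_le_kupisch i
  rw [succ]
  omega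

/-- `M` is the uniserial module whose composition factors, from the top to the socle, sit at the
vertices `a, a + 1, …, b - 1`. -/
def IsInterval (M : Type u) [AddCommGroup M] [Module Λ M] (a b : ℤ) : Prop :=
  a ≤ b ∧ D.IsUniserial M a (b - a).toNat

variable {D}

section

variable {M N : Type u} [AddCommGroup M] [Module Λ M] [AddCommGroup N] [Module Λ N] {a b a' b' : ℤ}

theorem IsInterval.le_succ (h : D.IsInterval M a b) : b ≤ D.succ a := by
  have := h.2.le_kupisch
  rw [succ]
  omega

theorem IsInterval.subsingleton_iff (h : D.IsInterval M a b) : Subsingleton M ↔ a = b := by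
  have := h.1
  rw [h.2.subsingleton_iff]
  omega

theorem IsInterval.nonempty_equiv (hM : D.IsInterval M a b) (hN : D.IsInterval N a b) :
    Nonempty (M ≃ₗ[Λ] N) :=
  hM.2.nonempty_equiv hN.2

theorem IsInterval.exists_eq_of_isDirectSummand (hM : D.IsInterval M a b)
    (hN : D.IsInterval N a' b') (hab : a < b) (h : IsDirectSummand (A := Λ) M N) :
    ∃ t : ℤ, a = a' + n * t ∧ b = b' + n * t := by
  obtain ⟨h₁, h₂⟩ := hM.2.eq_of_isDirectSummand hN.2 h (by omega)
  obtain ⟨t, ht⟩ := ZMod.intCast_eq_intCast_iff_exists_add.mp h₁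
  have := hN.1
  exact ⟨t, ht, by omega⟩

theorem IsInterval.not_isDirectSummand (hM : D.IsInterval M a b) (hab : a < b)
    (hN : Subsingleton N) : ¬ IsDirectSummand (A := Λ) M N := by
  rintro ⟨i, p, hip⟩
  have : Subsingleton M := ⟨fun u v => by
    rw [← LinearMap.id_apply (R := Λ) u, ← LinearMap.id_apply (R := Λ) v, ← hip,
      LinearMap.comp_apply, LinearMap.comp_apply, Subsingleton.elim (i u) (i v)]⟩
  exact hab.ne (hM.subsingleton_iff.mp this)

theorem IsInterval.isSimpleModule (h : D.IsInterval M a (a + 1)) : IsSimpleModule Λ M := by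
  have h2 := h.2
  rw [add_sub_cancel_left] at h2
  exact h2.isSimpleModule

theorem IsUniserial.exists_isInterval {i : ZMod n} {l : ℕ} (h : D.IsUniserial M i l) :
    ∃ a : ℤ, D.IsInterval M a (a + l) := by
  obtain ⟨a, rfl⟩ := ZMod.exists_intCast_eq i
  exact ⟨a, by omega, by rwa [add_sub_cancel_left, Int.toNat_natCast]⟩

end

theorem exists_isInterval_of_isSimpleModule (D : CyclicGenerators k Λ n) (M : Type u)
    [AddCommGroup M] [Module Λ M] [IsSimpleModule Λ M] : ∃ a : ℤ, D.IsInterval M a (a + 1) := by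
  obtain ⟨i, hi⟩ := D.exists_isUniserial_of_isSimpleModule M
  exact hi.exists_isInterval

theorem exists_isInterval (D : CyclicGenerators k Λ n) {a b : ℤ} (hab : a ≤ b)
    (hb : b ≤ D.succ a) : ∃ M : FGModuleCat.{u} Λ, D.IsInterval M a b := by
  rw [succ] at hb
  obtain ⟨M, hM⟩ := D.exists_isUniserial (a : ZMod n) (l := (b - a).toNat) (by omega)
  exact ⟨M, hab, hM⟩

section Syzygy

variable [IsArtinianRing Λ] {M : FGModuleCat.{u} Λ} {a b : ℤ}

theorem IsInterval.syzygy (h : D.IsInterval M a b) (hab : a < b) :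
    D.IsInterval (Homological.syzygy M) b (D.succ a) := by
  refine ⟨h.le_succ, ?_⟩
  have h' := h.2.syzygy (by omega)
  have hc : (a : ZMod n) + ((b - a).toNat : ZMod n) = (b : ZMod n) := by
    rw [← Int.cast_natCast, Int.toNat_of_nonneg (by omega), ← Int.cast_add, add_sub_cancel]
  rw [hc] at h'
  convert h' using 1
  rw [succ]
  omega

/-- The second syzygy applies `succ` to both ends. The strict bound on `b` ensures that the first
syzygy is nonzero, which the second application of `IsInterval.syzygy` requires. -/
theorem IsInterval.syzygy_two (h : D.IsInterval M a b) (hab : a < b) (hb : b < D.succ a) :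
    D.IsInterval (Homological.syzygy^[2] M : FGModuleCat.{u} Λ) (D.succ a) (D.succ b) :=
  (h.syzygy hab).syzygy hb

theorem IsInterval.projective_iff (h : D.IsInterval M a b) (hab : a < b) :
    Module.Projective Λ M ↔ b = D.succ a := by
  rw [h.2.projective_iff (by omega), succ]
  omega

theorem IsInterval.projective_of_eq (h : D.IsInterval M a b) (hab : b = D.succ a) :
    Module.Projective Λ M := by
  have := D.add_two_le_succ a
  exact (h.projective_iff (by omega)).mpr hab

theorem IsInterval.isDirectSummand_of_eq (h : D.IsInterval M a b) (hab : b = D.succ a) :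
    IsDirectSummand (A := Λ) M Λ := by
  have := D.add_two_le_succ a
  exact h.2.isDirectSummand_of_projective (by omega) (h.projective_of_eq hab)

/-! ### The finitistic dimension -/

variable (D)

theorem findim_le_iff_isInterval (d : ℕ) : findim Λ ≤ d ↔
    ∀ (M : FGModuleCat.{u} Λ) (a b : ℤ), a < b → D.IsInterval M a b →
      Module.Projective Λ (Homological.syzygy^[d + 1] M : FGModuleCat.{u} Λ) →
        Module.Projective Λ (Homological.syzygy^[d] M : FGModuleCat.{u} Λ) := by
  rw [findim_le_iff]
  refine ⟨fun h M _ _ _ _ => h M, fun h M => ?_⟩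
  induction M using D.induction_on_modules with
  | zero M hM =>
    exact fun _ => projective_syzygy_iterate_mono (s := 0) (Nat.zero_le d)
      (inferInstanceAs (Module.Projective Λ M))
  | prod X Y Z e hX hY =>
    rw [projective_syzygy_iterate_of_equiv_prod e, projective_syzygy_iterate_of_equiv_prod e]
    exact And.imp hX hY
  | uniserial M i l hl hM =>
    obtain ⟨a, ha⟩ := hM.exists_isInterval
    exact h M a _ (by omega) ha

/-- The syzygy `[b, succ a)` of a nonprojective interval is projective exactly when `succ a = succ
b`, and by monotonicity `succ` is then constant on `a, …, b`. Hence the simple modules `[a, a + 1)`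
suffice as tests. -/
theorem findim_le_zero_iff :
    findim Λ ≤ (0 : ℕ) ↔ ∀ a, D.succ a ≠ D.succ (a + 1) := by
  rw [D.findim_le_iff_isInterval]
  constructor
  · intro h a ha
    have h2 := D.add_two_le_succ a
    obtain ⟨M, hM⟩ := D.exists_isInterval (a := a) (b := a + 1) (by omega) (by omega)
    have hP := h M a (a + 1) (by omega) hM ((hM.syzygy (by omega)).projective_of_eq ha)
    have := (hM.projective_iff (by omega)).mp hP
    omega
  · intro h M a b hab hM hP
    by_cases hb : b = D.succ a
    · exact hM.projective_of_eq hb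
    have hb' := hM.le_succ
    have h1 := ((hM.syzygy hab).projective_iff (by omega)).mp hP
    exact absurd (le_antisymm (D.monotone_succ (by omega))
      ((D.monotone_succ (show a + 1 ≤ b by omega)).trans h1.ge)) (h a)

/-- The test modules are `[x, succ x - 1)`: the first syzygy is simple, hence not projective, and
the second is `[succ x, succ (succ x - 1))`. For a general `[a, b)` with `b < succ a`, projectivity
of a nonzero `[succ a, succ b)` squeezes `succ (succ a - 1)` between two equal values. -/
theorem findim_le_one_iff :
    findim Λ ≤ (1 : ℕ) ↔ ∀ x, D.succ (D.succ x - 1) ≠ D.succ (D.succ x) := by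
  rw [D.findim_le_iff_isInterval]
  constructor
  · intro h x hx
    have h2 := D.add_two_le_succ x
    have h3 := D.add_two_le_succ (D.succ x - 1)
    obtain ⟨M, hM⟩ := D.exists_isInterval (a := x) (b := D.succ x - 1) (by omega) (by omega)
    have hP := h M x _ (by omega) hM
      ((hM.syzygy_two (by omega) (by omega)).projective_of_eq hx)
    have := ((hM.syzygy (by omega)).projective_iff (by omega)).mp hP
    omega
  · intro h M a b hab hM hP
    by_cases hb : b = D.succ a
    · exact projective_syzygy (hM.projective_of_eq hb)
    have hb' := hM.le_succ
    have h1 := hM.syzygy hab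
    by_cases hs : D.succ a = D.succ b
    · exact h1.projective_of_eq hs
    have hle := D.monotone_succ hab.le
    have h2 := ((hM.syzygy_two hab (by omega)).projective_iff (by omega)).mp hP
    refine absurd (le_antisymm (D.monotone_succ (by omega)) ?_) (h a)
    rw [← h2]
    exact D.monotone_succ (by omega)

variable {D} in
/-- If no module has projective dimension three, then `D.succ` is injective on its image. -/
theorem succ_injOn_range
    (h : ∀ M : FGModuleCat.{u} Λ,
      Module.Projective Λ (Homological.syzygy^[3] M : FGModuleCat.{u} Λ) →
      Module.Projective Λ (Homological.syzygy^[2] M : FGModuleCat.{u} Λ))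
    (a b : ℤ) (hab : D.succ (D.succ a) = D.succ (D.succ b)) : D.succ a = D.succ b := by
  wlog hlt : D.succ a < D.succ b generalizing a b
  · rcases lt_trichotomy (D.succ a) (D.succ b) with h | h | h
    · exact absurd h hlt
    · exact h
    · exact (this b a hab.symm h).symm
  have h1 : a < b := D.monotone_succ.reflect_lt hlt
  have h2 := D.add_two_le_succ (D.succ b)
  -- Otherwise `succ (succ a) ≤ succ b < succ (succ b)`. So `[a, b)` is a nonprojective module,
  -- whose third syzygy is projective by `hab`.
  have h3 : b < D.succ a := by
    by_contra hb
    have := D.monotone_succ (not_lt.mp hb)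
    omega
  obtain ⟨M, hM⟩ := D.exists_isInterval h1.le h3.le
  have hM2 := hM.syzygy_two h1 h3
  have hM3 : D.IsInterval (Homological.syzygy^[3] M : FGModuleCat.{u} Λ) _ _ := hM2.syzygy hlt
  have := (hM2.projective_iff hlt).mp (h M (hM3.projective_of_eq hab))
  omega

/-! ### The delooping level -/

/-- A uniserial summand of a direct sum is a summand of one of the terms, so only syzygies of
intervals, which are explicit, need to be examined. -/
theorem isDirectSummand_syzygy_induction {U : Type u} [AddCommGroup U] [Module Λ U] {a b : ℤ}
    (hU : D.IsInterval U a b) (hab : a < b) (t : ℕ) {C : Prop}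
    (hC : ∀ (M : FGModuleCat.{u} Λ) (x y : ℤ), x < y → D.IsInterval M x y →
      IsDirectSummand (A := Λ) U (Homological.syzygy^[t] M : FGModuleCat.{u} Λ) → C)
    (M : FGModuleCat.{u} Λ)
    (h : IsDirectSummand (A := Λ) U (Homological.syzygy^[t] M : FGModuleCat.{u} Λ)) : C := by
  induction M using D.induction_on_modules with
  | zero M hM =>
    have hP : Module.Projective Λ M := inferInstance
    have hs : Subsingleton (Homological.syzygy^[t] M : FGModuleCat.{u} Λ) := by
      rcases t with _ | t
      · exact hM
      · rw [Function.iterate_succ_apply']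
        exact subsingleton_syzygy (projective_syzygy_iterate_mono (s := 0) (Nat.zero_le t) hP)
    exact (hU.not_isDirectSummand hab hs h).elim
  | prod X Y Z e hX hY =>
    obtain ⟨e'⟩ := nonempty_syzygy_iterate_prod e t
    exact (hU.2.isDirectSummand_or (h.trans (IsDirectSummand.of_equiv e')) (by omega)).elim hX hY
  | uniserial M i l hl hM =>
    obtain ⟨x, hx⟩ := hM.exists_isInterval
    exact hC M x _ (by omega) hx h

theorem exists_eq_of_isDirectSummand_syzygy {U : Type u} [AddCommGroup U] [Module Λ U] {a b : ℤ}
    (hU : D.IsInterval U a b) (hab : a < b) {M : FGModuleCat.{u} Λ}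
    (h : IsDirectSummand (A := Λ) U (Homological.syzygy M)) : ∃ x, b = D.succ x := by
  refine D.isDirectSummand_syzygy_induction hU hab 1 (fun M x y hxy hM h => ?_) M h
  obtain ⟨t, -, ht⟩ := hU.exists_eq_of_isDirectSummand (hM.syzygy hxy) hab h
  exact ⟨x + n * t, by rw [ht, D.succ_add_mul]⟩

theorem exists_eq_of_isDirectSummand_syzygy_two {U : Type u} [AddCommGroup U] [Module Λ U]
    {a b : ℤ} (hU : D.IsInterval U a b) (hab : a < b) {M : FGModuleCat.{u} Λ}
    (h : IsDirectSummand (A := Λ) U (Homological.syzygy^[2] M : FGModuleCat.{u} Λ)) :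
    ∃ x, a = D.succ x := by
  refine D.isDirectSummand_syzygy_induction hU hab 2 (fun M x y hxy hM h => ?_) M h
  by_cases hy : y = D.succ x
  · refine (hU.not_isDirectSummand hab ?_ h).elim
    exact subsingleton_syzygy (projective_syzygy (hM.projective_of_eq hy))
  · have := hM.le_succ
    obtain ⟨t, ht, -⟩ := hU.exists_eq_of_isDirectSummand (hM.syzygy_two hxy (by omega)) hab h
    exact ⟨x + n * t, by rw [ht, D.succ_add_mul]⟩

theorem isDirectSummand_prod_syzygy_cases {U : Type u} [AddCommGroup U] [Module Λ U] {a b : ℤ}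
    (hU : D.IsInterval U a b) (hab : a < b) {M : FGModuleCat.{u} Λ}
    (h : IsDirectSummand (A := Λ) U (Λ × M)) :
    b = D.succ a ∨ IsDirectSummand (A := Λ) U M := by
  have := hU.2.finite
  refine (hU.2.isDirectSummand_or h (by omega)).imp_left fun h => ?_
  obtain ⟨i, p, hip⟩ := h
  exact (IsInterval.projective_iff (M := FGModuleCat.of Λ U) hU hab).mp
    (Module.Projective.of_split i p hip)

theorem del_le_iff (d : ℕ) : del Λ ≤ d ↔ ∀ (S : FGModuleCat.{u} Λ) (a : ℤ),
    D.IsInterval S a (a + 1) → delModule S ≤ d := by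
  simp only [del, iSup_le_iff]
  constructor
  · exact fun h S a hS => h S hS.isSimpleModule
  · intro h S hS
    obtain ⟨a, ha⟩ := D.exists_isInterval_of_isSimpleModule S
    exact h S a ha

variable {D} in
-- If `a + 1 = succ x`, then the simple module `[a, a + 1)` is the syzygy of `[x, a)`.
theorem IsInterval.delModule_le_zero {S : FGModuleCat.{u} Λ} {a : ℤ}
    (hS : D.IsInterval S a (a + 1)) {x : ℤ} (hx : a + 1 = D.succ x) :
    delModule S ≤ (0 : ℕ) := by
  have h2 := D.add_two_le_succ x
  obtain ⟨M', hM'⟩ := D.exists_isInterval (a := x) (b := a) (by omega) (by omega)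
  have h1 := hM'.syzygy (by omega)
  rw [← hx] at h1
  obtain ⟨e⟩ := hS.nonempty_equiv h1
  exact (delModule_le_iff S 0).mpr ⟨0, le_rfl, M', (IsDirectSummand.of_equiv e).prod_right⟩

theorem del_le_zero_iff : del Λ ≤ (0 : ℕ) ↔ ∀ a, ∃ x, a = D.succ x := by
  rw [D.del_le_iff]
  constructor
  · intro h a
    have h2 := D.add_two_le_succ (a - 1)
    obtain ⟨S, hS⟩ := D.exists_isInterval (a := a - 1) (b := a - 1 + 1) (by omega) (by omega)
    obtain ⟨t, ht, M', hM'⟩ := (delModule_le_iff S 0).mp (h S _ hS)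
    obtain rfl : t = 0 := by omega
    rw [sub_add_cancel] at hS
    rcases D.isDirectSummand_prod_syzygy_cases (U := S) hS (by omega) hM' with h' | h'
    · exact ⟨_, h'⟩
    · exact D.exists_eq_of_isDirectSummand_syzygy hS (by omega) h'
  · intro h S a hS
    obtain ⟨x, hx⟩ := h (a + 1)
    exact hS.delModule_le_zero hx

/-- Either the simple `[a, a + 1)` is itself a syzygy up to projectives, so that its end `a + 1` is
a value of `succ`, or `[a + 1, succ a)` is projective or a summand of a second syzygy. In the last
case its top `a + 1` is again a value of `succ`. -/
theorem del_le_one_iff : del Λ ≤ (1 : ℕ) ↔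
    ∀ a, (∃ x, a + 1 = D.succ x) ∨ D.succ a = D.succ (a + 1) := by
  rw [D.del_le_iff]
  constructor
  · intro h a
    have h2 := D.add_two_le_succ a
    obtain ⟨S, hS⟩ := D.exists_isInterval (a := a) (b := a + 1) (by omega) (by omega)
    obtain ⟨t, ht, M', hM'⟩ := (delModule_le_iff S 1).mp (h S _ hS)
    obtain rfl | rfl : t = 0 ∨ t = 1 := by omega
    · rcases D.isDirectSummand_prod_syzygy_cases (U := S) hS (by omega) hM' with h' | h'
      · exact Or.inl ⟨_, h'⟩
      · exact Or.inl (D.exists_eq_of_isDirectSummand_syzygy hS (by omega) h')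
    · have hS1 := hS.syzygy (by omega)
      rcases D.isDirectSummand_prod_syzygy_cases hS1 (by omega) hM' with h' | h'
      · exact Or.inr h'
      · exact Or.inl (D.exists_eq_of_isDirectSummand_syzygy_two hS1 (by omega) h')
  · intro h S a hS
    rcases h a with ⟨x, hx⟩ | h'
    · exact (hS.delModule_le_zero hx).trans (by norm_num)
    · exact (delModule_le_iff S 1).mpr
        ⟨1, le_rfl, S, ((hS.syzygy (by omega)).isDirectSummand_of_eq h').prod_left⟩

/-- When `Ω² S = [succ a, succ (a + 1))` is neither zero nor projective, surjectivity of `succ` on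
its image gives `x` with `succ (succ x) = succ (a + 1)`. Then `[x, a)` has third syzygy `[succ a,
succ (succ x)) = Ω² S`. -/
theorem del_le_two (hinj : ∀ a b, D.succ (D.succ a) = D.succ (D.succ b) → D.succ a = D.succ b) :
    del Λ ≤ (2 : ℕ) := by
  rw [D.del_le_iff]
  intro S a hS
  rw [delModule_le_iff]
  have ha := D.add_two_le_succ a
  by_cases h₁ : D.succ a = D.succ (a + 1)
  · exact ⟨1, by omega, S, ((hS.syzygy (by omega)).isDirectSummand_of_eq h₁).prod_left⟩
  have hlt : D.succ a < D.succ (a + 1) := lt_of_le_of_ne (D.monotone_succ (by omega)) h₁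
  have hS2 := hS.syzygy_two (by omega) (by omega)
  by_cases h₂ : D.succ (a + 1) = D.succ (D.succ a)
  · exact ⟨2, le_rfl, S, (hS2.isDirectSummand_of_eq h₂).prod_left⟩
  obtain ⟨x, hx⟩ := exists_apply_apply_eq D.succ_add_mul hinj (a + 1)
  -- All inequalities needed for `[x, a)` to be a nonzero nonprojective module with nonprojective
  -- syzygy follow by reflecting strict inequalities through the monotone map `succ`.
  have h₃ : D.succ x < D.succ a := by
    refine D.monotone_succ.reflect_lt ?_
    rw [hx]
    exact lt_of_le_of_ne hS2.le_succ h₂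
  have h₄ : x < a := D.monotone_succ.reflect_lt h₃
  have h₅ : a < D.succ x := D.monotone_succ.reflect_lt (by rwa [hx])
  obtain ⟨M', hM'⟩ := D.exists_isInterval h₄.le h₅.le
  have hM3 : D.IsInterval (Homological.syzygy^[3] M' : FGModuleCat.{u} Λ) _ _ :=
    (hM'.syzygy_two h₄ h₅).syzygy h₃
  rw [hx] at hM3
  obtain ⟨e⟩ := hS2.nonempty_equiv hM3
  exact ⟨2, le_rfl, M', (IsDirectSummand.of_equiv e).prod_right⟩

end Syzygy

end CyclicGenerators

end

/-! ### The sum of the arrows and the ideal of long paths in the path algebra. -/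

noncomputable section

namespace PathAlgebra

variable {k : Type u} {n : ℕ} [Field k] [NeZero n]

variable (k n) in
/-- The sum of the arrows. -/
def arrowSum : PathAlgebra k n := ∑ i : ZMod n, monomial ⟨i, 1⟩ 1

theorem arrowSum_mul_monomial (p : CyclicPath n) (c : k) :
    arrowSum k n * monomial p c = monomial ⟨p.source, p.length + 1⟩ c := by
  rw [arrowSum, Finset.sum_mul, Finset.sum_eq_single p.target]
  · simp [monomial_mul_monomial, monomialMul, CyclicPath.after]
  · intro i _ hi
    simp [monomial_mul_monomial, monomialMul, hi.symm]
  · simp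

theorem arrowSum_pow_mul_monomial (s : ℕ) (p : CyclicPath n) (c : k) :
    arrowSum k n ^ s * monomial p c = monomial ⟨p.source, p.length + s⟩ c := by
  induction s with
  | zero => simp
  | succ s ih => rw [pow_succ', mul_assoc, ih, arrowSum_mul_monomial, add_assoc]

theorem monomial_mul_arrowSum (i : ZMod n) :
    monomial ⟨i + 1, 0⟩ 1 * arrowSum k n = monomial ⟨i, 1⟩ 1 := by
  rw [arrowSum, Finset.mul_sum, Finset.sum_eq_single i]
  · simp [monomial_mul_monomial, monomialMul, CyclicPath.after, CyclicPath.target]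
  · intro j _ hj
    simp [monomial_mul_monomial, monomialMul, CyclicPath.target, hj]
  · simp

theorem monomial_mul_vertex (p : CyclicPath n) (c : k) (i : ZMod n) :
    monomial p c * monomial ⟨i, 0⟩ 1 = if i = p.source then monomial p c else 0 := by
  rw [monomial_mul_monomial, monomialMul]
  simp only [CyclicPath.target, Nat.cast_zero, add_zero, mul_one]
  split_ifs with h
  · subst h
    simp [CyclicPath.after]
  · rfl

variable (k n) in
/-- The linear combinations of paths of length at least two. -/
def longPaths : AddSubgroup (PathAlgebra k n) :=
  AddSubgroup.closure {f | ∃ (p : CyclicPath n) (c : k), 2 ≤ p.length ∧ f = monomial p c}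

theorem monomial_mem_longPaths {p : CyclicPath n} (hp : 2 ≤ p.length) (c : k) :
    monomial p c ∈ longPaths k n :=
  AddSubgroup.subset_closure ⟨p, c, hp, rfl⟩

theorem monomialMul_mem_longPaths {p q : CyclicPath n} (h : 2 ≤ p.length ∨ 2 ≤ q.length) (c : k) :
    monomialMul p q c ∈ longPaths k n := by
  rw [monomialMul]
  split_ifs
  · refine monomial_mem_longPaths ?_ c
    simp only [CyclicPath.after]
    omega
  · exact AddSubgroup.zero_mem _

theorem mul_mem_longPaths_left (f : PathAlgebra k n) {g : PathAlgebra k n}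
    (hg : g ∈ longPaths k n) : f * g ∈ longPaths k n := by
  induction hg using AddSubgroup.closure_induction with
  | mem g hg =>
    obtain ⟨p, c, hp, rfl⟩ := hg
    induction f using induction_on with
    | h0 => rw [zero_mul]; exact AddSubgroup.zero_mem _
    | hadd f₁ f₂ h₁ h₂ => rw [add_mul]; exact AddSubgroup.add_mem _ h₁ h₂
    | hmon q b => rw [monomial_mul_monomial]; exact monomialMul_mem_longPaths (Or.inr hp) _
  | zero => rw [mul_zero]; exact AddSubgroup.zero_mem _
  | add g₁ g₂ _ _ h₁ h₂ => rw [mul_add]; exact AddSubgroup.add_mem _ h₁ h₂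
  | neg g _ h => rw [mul_neg]; exact AddSubgroup.neg_mem _ h

theorem mul_mem_longPaths_right {f : PathAlgebra k n} (hf : f ∈ longPaths k n)
    (g : PathAlgebra k n) : f * g ∈ longPaths k n := by
  induction hf using AddSubgroup.closure_induction with
  | mem f hf =>
    obtain ⟨p, c, hp, rfl⟩ := hf
    induction g using induction_on with
    | h0 => rw [mul_zero]; exact AddSubgroup.zero_mem _
    | hadd g₁ g₂ h₁ h₂ => rw [mul_add]; exact AddSubgroup.add_mem _ h₁ h₂
    | hmon q b => rw [monomial_mul_monomial]; exact monomialMul_mem_longPaths (Or.inl hp) _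
  | zero => rw [zero_mul]; exact AddSubgroup.zero_mem _
  | add f₁ f₂ _ _ h₁ h₂ => rw [add_mul]; exact AddSubgroup.add_mem _ h₁ h₂
  | neg f _ h => rw [neg_mul]; exact AddSubgroup.neg_mem _ h

/-- The coefficient of a path. -/
def coeffHom (p : CyclicPath n) : PathAlgebra k n →+ k where
  toFun f := (show CyclicPath n →₀ k from f) p
  map_zero' := rfl
  map_add' _ _ := rfl

theorem coeffHom_monomial_self (p : CyclicPath n) (c : k) : coeffHom p (monomial p c) = c :=
  Finsupp.single_eq_same

theorem coeffHom_eq_zero_of_mem_longPaths {f : PathAlgebra k n} (hf : f ∈ longPaths k n)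
    {p : CyclicPath n} (hp : p.length < 2) : coeffHom p f = 0 := by
  induction hf using AddSubgroup.closure_induction with
  | mem f hf =>
    obtain ⟨q, c, hq, rfl⟩ := hf
    have hne : p ≠ q := by
      rintro rfl
      omega
    exact Finsupp.single_eq_of_ne hne
  | zero => exact map_zero _
  | add f g _ _ hf hg => rw [map_add, hf, hg, add_zero]
  | neg f _ hf => rw [map_neg, hf, neg_zero]

variable (k n) in
/-- The ideal of the linear combinations of paths of length at least two. -/
def longPathsIdeal : TwoSidedIdeal (PathAlgebra k n) :=
  TwoSidedIdeal.mk' (longPaths k n) (AddSubgroup.zero_mem _) (AddSubgroup.add_mem _)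
    (AddSubgroup.neg_mem _) (mul_mem_longPaths_left _) (fun h => mul_mem_longPaths_right h _)

end PathAlgebra

/-! ### Cyclic Nakayama algebras satisfy the abstract axioms. -/

namespace NakayamaAlgebra

open PathAlgebra

variable (k : Type u) [Field k] {n : ℕ} [NeZero n] (R : RelationSystem n)

/-- The relations have length at least two, so they lie in the two-sided ideal of long paths.
Consequently no arrow vanishes in the quotient, which gives `succ i ≥ i + 2`. -/
theorem ideal_le_longPaths {f : PathAlgebra k n} (hf : f ∈ R.ideal k) : f ∈ longPaths k n := by
  have h : TwoSidedIdeal.span {x | ∃ p ∈ R.rels, x = monomial p (1 : k)} ≤ longPathsIdeal k n := by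
    rw [TwoSidedIdeal.span_le]
    rintro _ ⟨p, hp, rfl⟩
    exact (TwoSidedIdeal.mem_mk' ..).mpr (monomial_mem_longPaths (R.two_le_length p hp) 1)
  exact (TwoSidedIdeal.mem_mk' ..).mp (h hf)

theorem arrow_notMem_ideal (i : ZMod n) : monomial ⟨i, 1⟩ (1 : k) ∉ R.ideal k := fun h => by
  have h0 := coeffHom_eq_zero_of_mem_longPaths (ideal_le_longPaths k R h)
    (show (⟨i, 1⟩ : CyclicPath n).length < 2 from Nat.one_lt_two)
  rw [coeffHom_monomial_self] at h0
  exact one_ne_zero h0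

/-- The idempotents and the sum of the arrows generate a cyclic Nakayama algebra. -/
def cyclicGenerators : CyclicGenerators k (NakayamaAlgebra k R) n where
  e i := Ideal.Quotient.mk (R.ideal k) (monomial ⟨i, 0⟩ 1)
  x := Ideal.Quotient.mk (R.ideal k) (arrowSum k n)
  sum_e := by rw [← map_sum, ← one_def, map_one]
  e_mul_self i := by rw [← map_mul, monomial_mul_vertex, if_pos rfl]
  e_mul_e i j h := by rw [← map_mul, monomial_mul_vertex, if_neg (Ne.symm h), map_zero]
  x_mul_e i := by rw [← map_mul, ← map_mul, arrowSum_mul_monomial, monomial_mul_arrowSum]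
  exists_mul_e r i := by
    obtain ⟨f, rfl⟩ := Ideal.Quotient.mk_surjective r
    induction f using PathAlgebra.induction_on with
    | h0 => exact ⟨0, by simp⟩
    | hadd f g hf hg =>
      obtain ⟨p, hp⟩ := hf
      obtain ⟨q, hq⟩ := hg
      exact ⟨p + q, by rw [map_add, add_mul, hp, hq, map_add, add_mul]⟩
    | hmon p c =>
      rw [← map_mul, monomial_mul_vertex]
      split_ifs with h
      · refine ⟨Polynomial.monomial p.length c, ?_⟩
        rw [Polynomial.aeval_monomial, mul_assoc, ← map_pow, ← map_mul, arrowSum_pow_mul_monomial,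
          ← Algebra.smul_def, h, zero_add]
        have h2 : c • Ideal.Quotient.mk (R.ideal k) (monomial ⟨p.source, p.length⟩ 1) =
            Ideal.Quotient.mk (R.ideal k) (c • monomial ⟨p.source, p.length⟩ 1) := rfl
        rw [h2, smul_monomial, mul_one]
      · exact ⟨0, by simp⟩
  isNilpotent_x := by
    obtain ⟨r, hr⟩ := R.nonempty
    refine ⟨n + r.length, ?_⟩
    rw [← map_pow, ← mul_one (arrowSum k n ^ _), one_def, Finset.mul_sum, map_sum]
    refine Finset.sum_eq_zero fun i _ => ?_
    rw [arrowSum_pow_mul_monomial]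
    exact Ideal.Quotient.eq_zero_iff_mem.mpr (monomial_mem_ideal k R hr (by simp) 1)
  x_mul_e_ne_zero i := by
    rw [← map_mul, arrowSum_mul_monomial, Ne, Ideal.Quotient.eq_zero_iff_mem]
    exact arrow_notMem_ideal k R i

end NakayamaAlgebra

/-! ### Comparison of the bounds and conclusion. -/

theorem WithBot.eq_natCast_succ_iff (x : WithBot ℕ∞) (d : ℕ) :
    x = ((d + 1 : ℕ) : WithBot ℕ∞) ↔ x ≤ ((d + 1 : ℕ) : WithBot ℕ∞) ∧ ¬ x ≤ (d : WithBot ℕ∞) := by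
  have h : ∀ m : ℕ, (m : WithBot ℕ∞) = ((m : ℕ∞) : WithBot ℕ∞) := fun _ => rfl
  rw [h, h]
  induction x with
  | bot => exact iff_of_false WithBot.bot_ne_coe fun h => h.2 bot_le
  | coe x =>
    rw [WithBot.coe_le_coe, WithBot.coe_le_coe, WithBot.coe_inj]
    induction x with
    | top => exact iff_of_false (ENat.top_ne_natCast _) fun h =>
      ENat.natCast_ne_top _ (top_le_iff.mp h.1)
    | coe x => norm_cast; omega

theorem ENat.eq_natCast_succ_iff (x : ℕ∞) (d : ℕ) :
    x = ((d + 1 : ℕ) : ℕ∞) ↔ x ≤ ((d + 1 : ℕ) : ℕ∞) ∧ ¬ x ≤ (d : ℕ∞) := by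
  induction x with
  | top => exact iff_of_false (ENat.top_ne_natCast _) fun h =>
      ENat.natCast_ne_top _ (top_le_iff.mp h.1)
  | coe x => norm_cast; omega

open Homological in
/-- The values one and two of the finitistic dimension and of the delooping level agree if the
`φ`-dimension is at most two. -/
theorem CyclicGenerators.findim_eq_iff_del_eq {k Λ : Type u} [Field k] [Ring Λ] [Algebra k Λ]
    [IsArtinianRing Λ] {n : ℕ} [NeZero n] (D : CyclicGenerators k Λ n) (hphi : phiDim Λ ≤ (2 : ℕ)) :
    (findim Λ = (1 : ℕ) ↔ del Λ = (1 : ℕ)) ∧ (findim Λ = (2 : ℕ) ↔ del Λ = (2 : ℕ)) := by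
  have h₀ : findim Λ ≤ (0 : ℕ) ↔ del Λ ≤ (0 : ℕ) := by
    rw [D.findim_le_zero_iff, D.del_le_zero_iff]
    exact (D.monotone_succ.forall_mem_range_iff D.succ_add_mul).symm
  have h₁ : findim Λ ≤ (1 : ℕ) ↔ del Λ ≤ (1 : ℕ) := by
    rw [D.findim_le_one_iff, D.del_le_one_iff]
    exact D.monotone_succ.forall_increase_iff D.succ_add_mul
  have hpd : ∀ M : FGModuleCat.{u} Λ, Module.Projective Λ (syzygy^[3] M : FGModuleCat.{u} Λ) →
      Module.Projective Λ (syzygy^[2] M : FGModuleCat.{u} Λ) := fun _ =>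
    projective_syzygy_of_phiDim_le hphi
  -- Both bounds hold outright; this is the only comparison that depends on the `φ`-dimension.
  have h₂ : findim Λ ≤ (2 : ℕ) ↔ del Λ ≤ (2 : ℕ) :=
    iff_of_true ((findim_le_iff 2).mpr hpd) (D.del_le_two (CyclicGenerators.succ_injOn_range hpd))
  exact ⟨by rw [WithBot.eq_natCast_succ_iff, ENat.eq_natCast_succ_iff, h₀, h₁],
    by rw [WithBot.eq_natCast_succ_iff, ENat.eq_natCast_succ_iff, h₁, h₂]⟩

end

/-- For a cyclic Nakayama algebra `Λ = kQ / I` of `φ`-dimension two, the finitistic dimension is one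
(respectively two) if and only if the delooping level is one (respectively two). -/
theorem proposition3p3 {k : Type u} [Field k] {n : ℕ} [NeZero n] (R : RelationSystem n)
    (hphi : Homological.phiDim (NakayamaAlgebra k R) = 2) :
    (Homological.findim (NakayamaAlgebra k R) = 1 ↔ Homological.del (NakayamaAlgebra k R) = 1) ∧
    (Homological.findim (NakayamaAlgebra k R) = 2 ↔ Homological.del (NakayamaAlgebra k R) = 2) := by
  exact_mod_cast (NakayamaAlgebra.cyclicGenerators k R).findim_eq_iff_del_eq hphi.le
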